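/- Let $J:\mathbb R^2\to[0,\infty)$ be a measurable even function (the jump kernel) that is truncated and locally comparable to stable-like kernels: for all $z\in\mathbb R^2\setminus\{0\}$, $$\frac{\lambda}{|z|^{2+\beta}}\,\mathbf 1_{\{|z|\le\delta_1\}}\;\le\; J(z)\;\le\;\frac{\Lambda}{|z|^{2+\alpha}}\,\mathbf 1_{\{|z|\le\delta_0\}},$$ where $0<\alpha<2$, $0<\beta<2$, $0<\lambda\le\Lambda$ and $0<\delta_1\le\delta_0$. Let $c>0$ and $f\in C^1(\mathbb R)$, and let $$L[u](x)=\lim_{\varepsilon\to0^+}\int_{\{y\in\mathbb R^2:\,|x-y|>\varepsilon\}}\bigl(u(y)-u(x)\bigr)J(x-y)\,dy .$$ Let $u\in C^2(\mathbb R^2)$ be a bounded solution of $$\Delta u+c\,L[u]+f(u)=0\quad\text{in }\mathbb R^2$$ (the limit defining $L[u](x)$ existing at every $x$) which is stable, that is, for every $\zeta\in C^1_c(\mathbb R^2)$, $$\int_{\mathbb R^2}f'(u)\,\zeta^2\,dx\;\le\;\int_{\mathbb R^2}|\nabla\zeta|^2\,dx+\frac c2\iint_{\mathbb R^2\times\mathbb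 R^2}\bigl(\zeta(x)-\zeta(y)\bigr)^2J(x-y)\,dx\,dy .$$ Then $u$ is one-dimensional: there are a unit vector $\tau\in\mathbb R^2$ and a function $g\in C^2(\mathbb R)$ such that $u(x)=g(\tau\cdot x)$ for all $x\in\mathbb R^2$. -/

import Mathlib

/-- The Euclidean space `ℝⁿ`. -/
abbrev Eucl (n : ℕ) : Type := EuclideanSpace ℝ (Fin n)

/-- `J : ℝⁿ → ℝ` is a nonnegative, measurable, even jump kernel, which enters all formulas as
`J (x - y)`. -/
structure IsJumpKernel {n : ℕ} (J : Eucl n → ℝ) : Prop where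
  measurable : Measurable J
  nonneg : ∀ z, 0 ≤ J z
  even : ∀ z, J (-z) = J z

/-- The kernel is truncated: for every `z ≠ 0`,
`lam |z|^(-n-β) 1_{|z| ≤ δ₁} ≤ J z ≤ Lam |z|^(-n-α) 1_{|z| ≤ δ₀}`. -/
def TruncatedBounds {n : ℕ} (J : Eucl n → ℝ) (α β lam Lam δ₀ δ₁ : ℝ) : Prop :=
  ∀ z : Eucl n, z ≠ 0 →
    Set.indicator {w : Eucl n | ‖w‖ ≤ δ₁} (fun w => lam / ‖w‖ ^ ((n : ℝ) + β)) z ≤ J z ∧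
    J z ≤ Set.indicator {w : Eucl n | ‖w‖ ≤ δ₀} (fun w => Lam / ‖w‖ ^ ((n : ℝ) + α)) z

/-- `L[u](x) = ℓ`: the principal value
`lim_{ε → 0⁺} ∫_{|x - y| > ε} (u y - u x) J (x - y) dy` exists and equals `ℓ`; the truncated
integrals are required to converge absolutely. -/
def HasNonlocalValue {n : ℕ} (J : Eucl n → ℝ) (u : Eucl n → ℝ) (x : Eucl n) (ℓ : ℝ) : Prop :=
  (∀ ε : ℝ, 0 < ε →
    MeasureTheory.IntegrableOn (fun y => (u y - u x) * J (x - y)) {y | ε < ‖x - y‖}) ∧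
  Filter.Tendsto (fun ε : ℝ => ∫ y in {y | ε < ‖x - y‖}, (u y - u x) * J (x - y))
    (nhdsWithin 0 (Set.Ioi 0)) (nhds ℓ)

/-- `u` is a classical solution of `Δu + c L[u] + f(u) = 0` in `ℝⁿ`. -/
structure IsSolution {n : ℕ} (J : Eucl n → ℝ) (c : ℝ) (f : ℝ → ℝ) (u : Eucl n → ℝ) : Prop where
  contDiff : ContDiff ℝ 2 u
  equation : ∀ x, ∃ ℓ, HasNonlocalValue J u x ℓ ∧
    Laplacian.laplacian u x + c * ℓ + f (u x) = 0

/-- The stability inequality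
`∫ f'(u) ζ² ≤ ∫ |∇ζ|² + (c/2) ∬ (ζ(x) - ζ(y))² J(x - y)` for all `ζ ∈ C¹_c(ℝⁿ)`. -/
def IsStable {n : ℕ} (J : Eucl n → ℝ) (c : ℝ) (f : ℝ → ℝ) (u : Eucl n → ℝ) : Prop :=
  ∀ ζ : Eucl n → ℝ, ContDiff ℝ 1 ζ → HasCompactSupport ζ →
    ∫ x, deriv f (u x) * ζ x ^ 2 ≤
      (∫ x, ‖gradient ζ x‖ ^ 2) +
        c / 2 * ∫ p : Eucl n × Eucl n, (ζ p.1 - ζ p.2) ^ 2 * J (p.1 - p.2)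

/-- `u(x) = g(τ · x)` for a unit vector `τ` and a function `g ∈ C²(ℝ)`. -/
def IsOneDimensional {n : ℕ} (u : Eucl n → ℝ) : Prop :=
  ∃ τ : Eucl n, ‖τ‖ = 1 ∧ ∃ g : ℝ → ℝ, ContDiff ℝ 2 g ∧ ∀ x, u x = g (inner ℝ τ x)

open MeasureTheory Filter Topology Set

/-! The plan is to show that every directional derivative `v = ∂ₑu` has a sign. If `a = ∇u(x₀) ≠ 0`
and `e ⟂ a`, then `∂u` along `±e + s a` is positive at `x₀` for every `s > 0`, hence nonnegative
everywhere. Letting `s → 0` gives `∂ₑu = 0`, so `u` depends on one variable only.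

The function `v` solves the linearized equation weakly (`IsWeakSolution.fderiv_apply`). Testing the
equation of `u` with `u χ²` gives `∫_{B_R} |∇u|² ≤ C R²` in the plane. This growth is slow enough
for a logarithmic cutoff: some `η`, equal to 1 on any prescribed ball, makes the weighted energy of
`η`, which is the second variation at `v η`, as small as desired
(`exists_cutoff_weightedEnergy_le`).

Stability applied to `|a|` instead of `a` yields `c ∬ (|a(x)a(y)| - a(x)a(y)) J ≤ Q(a)`, where `Q`
is the second variation (`integral_abs_sub_le_secondVariation`). Take `a = v η + t ψ` with a bump
`ψ` inside `{η = 1}`. Since `v` is a solution, `Q(a) ≤ ε + t² Q(ψ)`, with no term linear in `t`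
(`IsWeakSolution.secondVariation_mul_add`). If `v ≥ 0` near `x₀` and `v < 0` at a point within the
range of `J`, the left side is at least a positive multiple of `t`, which is impossible for small
`ε` and `t`. Thus nonnegativity spreads by jumps of fixed length. The bump covers the case where `v`
vanishes near `x₀`, so no unique continuation is needed. -/

/-! ### Truncated kernels and their second moment -/

/-- An even jump kernel of range at most `δ` with finite second moment. -/
structure IsTruncatedKernel {n : ℕ} (J : Eucl n → ℝ) (δ : ℝ) : Prop extends IsJumpKernel J where
  pos : 0 < δ
  moment : Integrable fun z => ‖z‖ ^ 2 * J z
  range : ∀ z, δ < ‖z‖ → J z = 0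

/-- In polar coordinates the bound `Lam |z|^(2-n-α)` becomes `Lam r^(1-α)`, integrable at 0 because
`α < 2`. The upper bound on `J` enters the proof only here. -/
theorem TruncatedBounds.isTruncatedKernel {n : ℕ} [NeZero n] {J : Eucl n → ℝ} (hJ : IsJumpKernel J)
    {α β lam Lam δ₀ δ₁ : ℝ} (hα2 : α < 2) (hδ : 0 < δ₀)
    (h : TruncatedBounds J α β lam Lam δ₀ δ₁) : IsTruncatedKernel J δ₀ := by
  have hrange : ∀ z, δ₀ < ‖z‖ → J z = 0 := by
    intro z hz
    have hz0 : z ≠ 0 := by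
      rintro rfl
      simp at hz
      linarith
    have h2 := (h z hz0).2
    rw [indicator_of_notMem (by simpa using hz)] at h2
    exact le_antisymm h2 (hJ.nonneg z)
  refine ⟨hJ, hδ, ?_, hrange⟩
  have hpow : Integrable (fun z : Eucl n =>
      (indicator (Iic δ₀) (fun r : ℝ => Lam * r ^ (2 - ((n : ℝ) + α)))) ‖z‖) := by
    have : Nontrivial (Eucl n) := by
      apply Module.nontrivial_of_finrank_pos (R := ℝ)
      simpa using NeZero.pos n
    rw [integrable_fun_norm_addHaar]
    have hI : IntegrableOn (fun r : ℝ => Lam * r ^ (1 - α)) (Ioc 0 δ₀) := by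
      have := (intervalIntegral.intervalIntegrable_rpow' (a := 0) (b := δ₀) (r := 1 - α)
        (by linarith)).const_mul Lam
      rwa [intervalIntegrable_iff_integrableOn_Ioc_of_le hδ.le] at this
    rw [← integrable_indicator_iff measurableSet_Ioc] at hI
    rw [← integrable_indicator_iff measurableSet_Ioi]
    refine hI.congr (Eventually.of_forall fun r => ?_)
    by_cases hr : 0 < r
    · by_cases hr' : r ≤ δ₀
      · simp only [indicator, mem_Ioc, mem_Ioi, mem_Iic, hr, hr', and_self, if_true, smul_eq_mul]
        have : (r : ℝ) ^ (Module.finrank ℝ (Eucl n) - 1) = r ^ ((n : ℝ) - 1) := by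
          rw [← Real.rpow_natCast]
          congr 1
          have : 1 ≤ n := NeZero.pos n
          simp [Nat.cast_sub this]
        rw [this, mul_left_comm, ← Real.rpow_add hr]
        congr 2
        ring
      · simp [indicator, hr']
    · simp [indicator, hr]
  refine hpow.mono' ((measurable_norm.pow_const 2).mul hJ.measurable).aestronglyMeasurable
    (Eventually.of_forall fun z => ?_)
  rw [Real.norm_of_nonneg (mul_nonneg (by positivity) (hJ.nonneg z))]
  by_cases hz : z = 0
  -- The majorant may be nonzero at the origin, because `0 ^ 0 = 1`, so the sign of `Lam` is needed;
  -- it is read off at a point of norm `δ₀`.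
  · subst hz
    have hL : 0 ≤ Lam := by
      have : Nontrivial (Eucl n) := by
        apply Module.nontrivial_of_finrank_pos (R := ℝ)
        simpa using NeZero.pos n
      obtain ⟨w, hw⟩ := exists_norm_eq (Eucl n) hδ.le
      have hw0 : w ≠ 0 := by
        rintro rfl
        simp at hw
        linarith
      have h2 := (hJ.nonneg w).trans (h w hw0).2
      rw [indicator_of_mem (by simpa using hw.le)] at h2
      have hp : 0 < ‖w‖ ^ ((n : ℝ) + α) := Real.rpow_pos_of_pos (norm_pos_iff.2 hw0) _
      by_contra hL
      exact absurd h2 (not_le.2 (div_neg_of_neg_of_pos (not_le.1 hL) hp))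
    simp only [norm_zero, ne_eq, OfNat.ofNat_ne_zero, not_false_eq_true, zero_pow, zero_mul]
    rw [indicator_of_mem (by simpa using hδ.le)]
    exact mul_nonneg hL (Real.rpow_nonneg le_rfl _)
  · by_cases hz' : ‖z‖ ≤ δ₀
    · have h2 := (h z hz).2
      rw [indicator_of_mem (by simpa using hz')] at h2 ⊢
      have hp : 0 < ‖z‖ := norm_pos_iff.2 hz
      rw [Real.rpow_sub hp, Real.rpow_two]
      calc ‖z‖ ^ 2 * J z ≤ ‖z‖ ^ 2 * (Lam / ‖z‖ ^ ((n : ℝ) + α)) := by gcongr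
        _ = _ := by ring
    · rw [hrange z (not_le.1 hz'), indicator_of_notMem (by simpa using hz')]
      simp

namespace IsTruncatedKernel

variable {n : ℕ} {J : Eucl n → ℝ} {δ : ℝ}

theorem symm (hJ : IsTruncatedKernel J δ) (x y : Eucl n) : J (y - x) = J (x - y) := by
  rw [← hJ.even, neg_sub]

theorem measurable_sub (hJ : IsTruncatedKernel J δ) :
    Measurable fun p : Eucl n × Eucl n => J (p.1 - p.2) :=
  hJ.measurable.comp (measurable_fst.sub measurable_snd)

theorem integrable_snd_mul (hJ : IsTruncatedKernel J δ) {g : Eucl n → ℝ} (hg : Integrable g) :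
    Integrable fun p : Eucl n × Eucl n => g p.2 * (‖p.1 - p.2‖ ^ 2 * J (p.1 - p.2)) :=
  hg.convolution_integrand (ContinuousLinearMap.mul ℝ ℝ) hJ.moment

theorem integrable_fst_mul (hJ : IsTruncatedKernel J δ) {g : Eucl n → ℝ} (hg : Integrable g) :
    Integrable fun p : Eucl n × Eucl n => g p.1 * (‖p.1 - p.2‖ ^ 2 * J (p.1 - p.2)) := by
  refine (hJ.integrable_snd_mul hg).swap.congr (Eventually.of_forall fun p => ?_)
  simp only [Function.comp, Prod.fst_swap, Prod.snd_swap, hJ.symm p.1 p.2, norm_sub_rev p.2 p.1]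

theorem integral_snd_mul (hJ : IsTruncatedKernel J δ) {g : Eucl n → ℝ} (hg : Integrable g) :
    ∫ p : Eucl n × Eucl n, g p.2 * (‖p.1 - p.2‖ ^ 2 * J (p.1 - p.2)) =
      (∫ x, g x) * ∫ z, ‖z‖ ^ 2 * J z := by
  rw [Measure.volume_eq_prod, integral_prod_symm _ (hJ.integrable_snd_mul hg), ← integral_mul_const]
  refine integral_congr_ae (Eventually.of_forall fun y => ?_)
  simp only
  rw [integral_const_mul, integral_sub_right_eq_self (fun z => ‖z‖ ^ 2 * J z) y]

theorem integral_fst_mul (hJ : IsTruncatedKernel J δ) {g : Eucl n → ℝ} (hg : Integrable g) :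
    ∫ p : Eucl n × Eucl n, g p.1 * (‖p.1 - p.2‖ ^ 2 * J (p.1 - p.2)) =
      (∫ x, g x) * ∫ z, ‖z‖ ^ 2 * J z := by
  rw [← hJ.integral_snd_mul hg, Measure.volume_eq_prod, ← integral_prod_swap]
  refine integral_congr_ae (Eventually.of_forall fun p => ?_)
  simp only [Prod.fst_swap, Prod.snd_swap, hJ.symm p.1 p.2, norm_sub_rev p.2 p.1]

theorem moment_nonneg (hJ : IsTruncatedKernel J δ) : 0 ≤ ∫ z, ‖z‖ ^ 2 * J z :=
  integral_nonneg fun z => mul_nonneg (by positivity) (hJ.nonneg z)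

/-- A pair integrand that is `O(|x - y|²)` in the range of the kernel is bounded against the second
moment density. -/
theorem norm_mul_le (hJ : IsTruncatedKernel J δ) {a b : ℝ} {x y : Eucl n}
    (h : ‖x - y‖ ≤ δ → |a| ≤ b * ‖x - y‖ ^ 2) :
    ‖a * J (x - y)‖ ≤ b * (‖x - y‖ ^ 2 * J (x - y)) := by
  rw [norm_mul, Real.norm_eq_abs, Real.norm_of_nonneg (hJ.nonneg _), ← mul_assoc]
  by_cases hxy : ‖x - y‖ ≤ δ
  · exact mul_le_mul_of_nonneg_right (h hxy) (hJ.nonneg _)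
  · simp [hJ.range _ (not_le.1 hxy)]

theorem integrable_of_bound (hJ : IsTruncatedKernel J δ) {G : Eucl n × Eucl n → ℝ}
    (hG : Measurable G) {g : Eucl n → ℝ} (hg : Integrable g)
    (hb : ∀ p : Eucl n × Eucl n, ‖p.1 - p.2‖ ≤ δ → |G p| ≤ g p.1 * ‖p.1 - p.2‖ ^ 2) :
    Integrable fun p : Eucl n × Eucl n => G p * J (p.1 - p.2) :=
  (hJ.integrable_fst_mul hg).mono' (hG.mul hJ.measurable_sub).aestronglyMeasurable
    (Eventually.of_forall fun p => hJ.norm_mul_le (hb p))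

end IsTruncatedKernel

/-! ### Calculus of partial derivatives -/

/-- The `i`-th partial derivative. -/
noncomputable def pderiv {n : ℕ} (i : Fin n) (a : Eucl n → ℝ) (x : Eucl n) : ℝ :=
  fderiv ℝ a x (EuclideanSpace.single i 1)

section pderiv

variable {n : ℕ} {a b : Eucl n → ℝ} {i : Fin n}

theorem continuous_pderiv (ha : ContDiff ℝ 1 a) : Continuous (pderiv i a) :=
  (ha.continuous_fderiv one_ne_zero).clm_apply continuous_const

theorem contDiff_pderiv (ha : ContDiff ℝ 2 a) : ContDiff ℝ 1 (pderiv i a) :=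
  (ha.fderiv_right (m := 1) (by norm_num)).clm_apply contDiff_const

theorem pderiv_mul (ha : ContDiff ℝ 1 a) (hb : ContDiff ℝ 1 b) (x : Eucl n) :
    pderiv i (fun y => a y * b y) x = a x * pderiv i b x + b x * pderiv i a x := by
  have h1 := ha.differentiable one_ne_zero x
  have h2 := hb.differentiable one_ne_zero x
  simp [pderiv, fderiv_fun_mul h1 h2]

theorem pderiv_add (ha : ContDiff ℝ 1 a) (hb : ContDiff ℝ 1 b) (x : Eucl n) :
    pderiv i (fun y => a y + b y) x = pderiv i a x + pderiv i b x := by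
  have h1 := ha.differentiable one_ne_zero x
  have h2 := hb.differentiable one_ne_zero x
  simp [pderiv, fderiv_fun_add h1 h2]

theorem pderiv_const_mul (ha : ContDiff ℝ 1 a) (t : ℝ) (x : Eucl n) :
    pderiv i (fun y => t * a y) x = t * pderiv i a x := by
  have h1 := ha.differentiable one_ne_zero x
  simp [pderiv, fderiv_const_mul h1]

theorem pderiv_sum {ι : Type*} (s : Finset ι) {b : ι → Eucl n → ℝ}
    (hb : ∀ k ∈ s, ContDiff ℝ 1 (b k)) (x : Eucl n) :
    pderiv i (fun y => ∑ k ∈ s, b k y) x = ∑ k ∈ s, pderiv i (b k) x := by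
  simp only [pderiv]
  rw [fderiv_fun_sum fun k hk => (hb k hk).differentiable one_ne_zero x]
  simp

theorem pderiv_eq_zero_of_eventually_const {k : ℝ} {x : Eucl n} (h : ∀ᶠ y in 𝓝 x, a y = k) :
    pderiv i a x = 0 := by
  have : fderiv ℝ a x = fderiv ℝ (fun _ => k) x := EventuallyEq.fderiv_eq h
  simp [pderiv, this]

theorem hasCompactSupport_pderiv (ha : HasCompactSupport a) : HasCompactSupport (pderiv i a) :=
  ha.fderiv_apply ℝ _

theorem abs_pderiv_le (x : Eucl n) : |pderiv i a x| ≤ ‖fderiv ℝ a x‖ := by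
  simpa [pderiv] using (fderiv ℝ a x).le_opNorm (EuclideanSpace.single i 1)

theorem norm_gradient_sq (x : Eucl n) : ‖gradient a x‖ ^ 2 = ∑ i, pderiv i a x ^ 2 := by
  rw [← (EuclideanSpace.basisFun (Fin n) ℝ).sum_sq_norm_inner_left]
  refine Finset.sum_congr rfl fun i _ => ?_
  rw [gradient, InnerProductSpace.toDual_symm_apply]
  simp [pderiv]

theorem norm_fderiv_sq (x : Eucl n) : ‖fderiv ℝ a x‖ ^ 2 = ∑ i, pderiv i a x ^ 2 := by
  rw [← norm_gradient_sq, gradient, LinearIsometryEquiv.norm_map]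

theorem laplacian_eq_sum_pderiv (ha : ContDiff ℝ 2 a) (x : Eucl n) :
    Laplacian.laplacian a x = ∑ i, pderiv i (pderiv i a) x := by
  rw [InnerProductSpace.laplacian_eq_iteratedFDeriv_orthonormalBasis a
    (EuclideanSpace.basisFun (Fin n) ℝ)]
  refine Finset.sum_congr rfl fun i _ => ?_
  have h : DifferentiableAt ℝ (fderiv ℝ a) x :=
    (ha.fderiv_right (m := 1) (by norm_num)).differentiable one_ne_zero x
  rw [iteratedFDeriv_two_apply]
  unfold pderiv
  rw [fderiv_clm_apply h (differentiableAt_const _)]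
  simp

end pderiv

/-! ### Integrability of the nonlocal pair integrand -/

section pairs

variable {n : ℕ} {J : Eucl n → ℝ} {δ : ℝ}

theorem HasCompactSupport.exists_eq_zero_of_lt_norm {φ : Eucl n → ℝ} (hφ : HasCompactSupport φ) :
    ∃ R : ℝ, 0 < R ∧ ∀ x, R < ‖x‖ → φ x = 0 := by
  obtain ⟨R, hR, h⟩ := hφ.isCompact.isBounded.exists_pos_norm_le
  refine ⟨R, hR, fun x hx => ?_⟩
  by_contra h0
  exact absurd (h x (subset_tsupport _ h0)) (not_le.2 hx)

/-- The dominating density of pair integrands on a ball. -/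
noncomputable def ballConst (n : ℕ) (R A : ℝ) : Eucl n → ℝ :=
  (Metric.closedBall (0 : Eucl n) R).indicator fun _ => A

theorem integrable_ballConst (R A : ℝ) : Integrable (ballConst n R A) :=
  (integrable_indicator_iff Metric.isClosed_closedBall.measurableSet).2
    (integrableOn_const measure_closedBall_lt_top.ne)

theorem ballConst_of_le {R A : ℝ} {x : Eucl n} (h : ‖x‖ ≤ R) : ballConst n R A x = A :=
  indicator_of_mem (by simpa using h) _

theorem ballConst_of_lt {R A : ℝ} {x : Eucl n} (h : R < ‖x‖) : ballConst n R A x = 0 :=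
  indicator_of_notMem (by simpa using h) _

theorem ballConst_nonneg {R A : ℝ} (hA : 0 ≤ A) (x : Eucl n) : 0 ≤ ballConst n R A x :=
  indicator_nonneg (fun _ _ => hA) x

/-- The product vanishes unless one of the points lies in `B_R`; within the range `δ` both then lie
in `B_{R+δ}`. Hence the factor `d` needs a Lipschitz bound only locally. -/
theorem abs_sub_mul_sub_le {R A B d e : ℝ} {φ : Eucl n → ℝ} (hA : 0 ≤ A) (hB : 0 ≤ B)
    (hφ0 : ∀ x, R < ‖x‖ → φ x = 0) {x y : Eucl n}
    (hφ : |φ x - φ y| ≤ B * ‖x - y‖)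
    (hd : ‖x‖ ≤ R + δ → ‖y‖ ≤ R + δ → |d| ≤ A * ‖x - y‖) (he : e = φ x - φ y)
    (hxy : ‖x - y‖ ≤ δ) :
    |d * e| ≤ ballConst n (R + δ) (A * B) x * ‖x - y‖ ^ 2 := by
  subst he
  have hδ : 0 ≤ δ := (norm_nonneg _).trans hxy
  have h1 : ‖x‖ ≤ ‖y‖ + ‖x - y‖ := by simpa using norm_le_insert' x y
  have h2 : ‖y‖ ≤ ‖x‖ + ‖x - y‖ := norm_le_insert x y
  by_cases hx : ‖x‖ ≤ R ∨ ‖y‖ ≤ R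
  · have hx' : ‖x‖ ≤ R + δ := by rcases hx with h | h <;> linarith
    have hy' : ‖y‖ ≤ R + δ := by rcases hx with h | h <;> linarith
    rw [ballConst_of_le hx', abs_mul]
    calc |d| * |φ x - φ y| ≤ (A * ‖x - y‖) * (B * ‖x - y‖) := by
          gcongr
          exact hd hx' hy'
      _ = _ := by ring
  · push Not at hx
    rw [hφ0 x hx.1, hφ0 y hx.2]
    simp only [sub_self, mul_zero, abs_zero]
    exact mul_nonneg (ballConst_nonneg (mul_nonneg hA hB) _) (by positivity)

theorem ContDiff.exists_abs_sub_le_on_ball {a : Eucl n → ℝ} (ha : ContDiff ℝ 1 a) (R : ℝ) :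
    ∃ A : ℝ, 0 ≤ A ∧ ∀ x y, ‖x‖ ≤ R → ‖y‖ ≤ R → |a x - a y| ≤ A * ‖x - y‖ := by
  obtain ⟨K, hK⟩ := (ha.contDiffOn (s := Metric.closedBall 0 R)).exists_lipschitzOnWith one_ne_zero
    (convex_closedBall _ _) (isCompact_closedBall _ _)
  refine ⟨K, K.2, fun x y hx hy => ?_⟩
  have := hK.dist_le_mul x (by simpa using hx) y (by simpa using hy)
  rwa [Real.dist_eq, dist_eq_norm] at this

theorem ContDiff.exists_abs_sub_le {φ : Eucl n → ℝ} (hφ : ContDiff ℝ 1 φ)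
    (hc : HasCompactSupport φ) : ∃ B : ℝ, 0 ≤ B ∧ ∀ x y, |φ x - φ y| ≤ B * ‖x - y‖ := by
  obtain ⟨K, hK⟩ := hφ.lipschitzWith_of_hasCompactSupport hc one_ne_zero
  refine ⟨K, K.2, fun x y => ?_⟩
  have := hK.dist_le_mul x y
  rwa [Real.dist_eq, dist_eq_norm] at this

/-- The pair integrand of the nonlocal energy. -/
def pairDensity (J a b : Eucl n → ℝ) (p : Eucl n × Eucl n) : ℝ :=
  (a p.1 - a p.2) * (b p.1 - b p.2) * J (p.1 - p.2)

theorem integrable_pairDensity (hJ : IsTruncatedKernel J δ) {a b : Eucl n → ℝ}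
    (ha : ContDiff ℝ 1 a) (hb : ContDiff ℝ 1 b) (hc : HasCompactSupport b) :
    Integrable (pairDensity J a b) := by
  obtain ⟨R, -, h0⟩ := hc.exists_eq_zero_of_lt_norm
  obtain ⟨A, hA, hA'⟩ := ha.exists_abs_sub_le_on_ball (R + δ)
  obtain ⟨B, hB, hB'⟩ := hb.exists_abs_sub_le hc
  have hac := ha.continuous
  have hbc := hb.continuous
  refine hJ.integrable_of_bound (by fun_prop) (integrable_ballConst (R + δ) (A * B))
    fun p hp => abs_sub_mul_sub_le hA hB h0 (hB' _ _) (hA' _ _) rfl hp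

end pairs

/-! ### From the principal value to the weak formulation -/

section weak

variable {n : ℕ} {J : Eucl n → ℝ} {δ : ℝ}

/-- The derivative is Lipschitz on `B_{R+δ}`, so the first-order Taylor remainders at `z` and `-z`
are `O(|z|²)`, and the linear terms cancel in the sum. -/
theorem ContDiff.exists_abs_second_difference_le {u : Eucl n → ℝ} (hu : ContDiff ℝ 2 u) (R δ : ℝ) :
    ∃ A : ℝ, 0 ≤ A ∧ ∀ x z, ‖x‖ ≤ R → ‖z‖ ≤ δ →
      |u (x - z) + u (x + z) - 2 * u x| ≤ 2 * A * ‖z‖ ^ 2 := by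
  obtain ⟨K, hK⟩ := ((hu.fderiv_right (m := 1) (by norm_num)).contDiffOn
    (s := Metric.closedBall 0 (R + δ))).exists_lipschitzOnWith one_ne_zero
    (convex_closedBall _ _) (isCompact_closedBall _ _)
  refine ⟨K, K.2, fun x z hx hz => ?_⟩
  have key : ∀ w : Eucl n, ‖w‖ = ‖z‖ →
      ‖u (x + w) - u x - fderiv ℝ u x w‖ ≤ K * ‖z‖ ^ 2 := by
    intro w hw
    have := Convex.norm_image_sub_le_of_norm_fderiv_le' (𝕜 := ℝ) (f := u) (C := K * ‖z‖)
      (s := Metric.closedBall x ‖z‖) (x := x) (y := x + w) (φ := fderiv ℝ u x)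
      (fun y _ => hu.differentiable two_ne_zero y) (fun y hy => ?_) (convex_closedBall _ _)
      (by simp) (by simp [hw])
    · simpa [hw, mul_assoc, sq] using this
    · rw [mem_closedBall_iff_norm] at hy
      have h1 : ‖y‖ ≤ ‖x‖ + ‖y - x‖ := norm_le_insert' y x
      have := hK.dist_le_mul y (by simp; linarith) x (by simp; linarith [norm_nonneg z])
      rw [dist_eq_norm, dist_eq_norm] at this
      exact this.trans (by gcongr)
  have h1 := key z rfl
  have h2 := key (-z) (norm_neg z)
  rw [Real.norm_eq_abs] at h1 h2
  have e : u (x - z) + u (x + z) - 2 * u x =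
      (u (x + z) - u x - fderiv ℝ u x z) + (u (x + -z) - u x - fderiv ℝ u x (-z)) := by
    rw [map_neg, ← sub_eq_add_neg]
    ring
  rw [e]
  exact (abs_add_le _ _).trans (by linarith)

/-- Averaging over `z` and `-z`, which is allowed since `J` is even, turns the increment into a
second difference. The bound does not depend on `ε` and serves as a majorant for `ε → 0`. -/
theorem IsTruncatedKernel.abs_truncated_integral_le (hJ : IsTruncatedKernel J δ) {u : Eucl n → ℝ}
    {M : ℝ} (hM : ∀ x, |u x| ≤ M) (hu : Measurable u) {A : ℝ} {x : Eucl n}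
    (hA : ∀ z, ‖z‖ ≤ δ → |u (x - z) + u (x + z) - 2 * u x| ≤ 2 * A * ‖z‖ ^ 2) {ε : ℝ}
    (hε : 0 < ε) :
    |∫ y in {y | ε < ‖x - y‖}, (u y - u x) * J (x - y)| ≤ A * ∫ z, ‖z‖ ^ 2 * J z := by
  have hmeas : MeasurableSet {y : Eucl n | ε < ‖x - y‖} :=
    measurableSet_lt measurable_const (measurable_const.sub measurable_id).norm
  have hmeas' : MeasurableSet {z : Eucl n | ε < ‖z‖} :=
    measurableSet_lt measurable_const measurable_norm
  set g : Eucl n → ℝ := {z : Eucl n | ε < ‖z‖}.indicator fun z => (u (x - z) - u x) * J z with hg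
  have hgm : Measurable g :=
    (((hu.comp (measurable_const.sub measurable_id)).sub_const _).mul hJ.measurable).indicator hmeas'
  have hgi : Integrable g := by
    refine (hJ.moment.const_mul (2 * M / ε ^ 2)).mono' hgm.aestronglyMeasurable
      (Eventually.of_forall fun z => ?_)
    have hJz := hJ.nonneg z
    have hM0 : 0 ≤ M := (abs_nonneg _).trans (hM x)
    by_cases hz : ε < ‖z‖
    · rw [hg, indicator_of_mem (by exact hz), norm_mul, Real.norm_eq_abs, Real.norm_of_nonneg hJz,
        ← mul_assoc]
      gcongr
      have h1 : |u (x - z) - u x| ≤ 2 * M :=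
        (abs_sub _ _).trans (by linarith [hM (x - z), hM x])
      have h2 : ε ^ 2 ≤ ‖z‖ ^ 2 := by gcongr
      calc _ ≤ 2 * M := h1
        _ = 2 * M / ε ^ 2 * ε ^ 2 := by field_simp
        _ ≤ _ := by gcongr
    · rw [hg, indicator_of_notMem (by exact hz)]
      simp only [norm_zero]
      positivity
  have e1 : ∫ y in {y | ε < ‖x - y‖}, (u y - u x) * J (x - y) = ∫ z, g z := by
    rw [← integral_indicator hmeas, ← integral_sub_left_eq_self g volume x]
    refine integral_congr_ae (Eventually.of_forall fun y => ?_)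
    simp [hg, indicator]
  have e2 : 2 * ∫ z, g z = ∫ z, (g z + g (-z)) := by
    rw [integral_add hgi hgi.comp_neg, integral_neg_eq_self]
    ring
  have e3 : |∫ z, (g z + g (-z))| ≤ ∫ z, 2 * A * (‖z‖ ^ 2 * J z) := by
    rw [← Real.norm_eq_abs]
    refine norm_integral_le_of_norm_le (hJ.moment.const_mul _) (Eventually.of_forall fun z => ?_)
    have hJz := hJ.nonneg z
    have hb : ‖(u (x - z) + u (x + z) - 2 * u x) * J z‖ ≤ 2 * A * (‖z‖ ^ 2 * J z) := by
      rw [norm_mul, Real.norm_eq_abs, Real.norm_of_nonneg hJz, ← mul_assoc]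
      by_cases hz : ‖z‖ ≤ δ
      · gcongr
        exact hA z hz
      · simp [hJ.range z (not_le.1 hz)]
    by_cases hz : ε < ‖z‖
    · simp only [hg]
      rw [indicator_of_mem (by exact hz), indicator_of_mem (by simpa using hz), hJ.even,
        sub_neg_eq_add]
      exact le_of_eq_of_le (congrArg _ (by ring)) hb
    · simp only [hg]
      rw [indicator_of_notMem (by exact hz), indicator_of_notMem (by simpa using hz)]
      simpa using (norm_nonneg _).trans hb
  rw [integral_const_mul, ← e2, abs_mul, abs_two] at e3
  rw [e1]
  linarith

/-- For fixed `ε` the double integral converges absolutely, and exchanging `x` and `y` symmetrizes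
it to `-1/2` times the truncated pair integral. Both forms pass to the limit by dominated
convergence. -/
theorem IsTruncatedKernel.integral_nonlocal_mul (hJ : IsTruncatedKernel J δ) {u φ ℓ : Eucl n → ℝ}
    {M : ℝ} (hM : ∀ x, |u x| ≤ M) (hu : ContDiff ℝ 2 u) (hℓ : ∀ x, HasNonlocalValue J u x (ℓ x))
    (hφ : ContDiff ℝ 1 φ) (hc : HasCompactSupport φ) :
    ∫ x, φ x * ℓ x = -(1 / 2) * ∫ p, pairDensity J u φ p := by
  have hM0 : 0 ≤ M := (abs_nonneg _).trans (hM 0)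
  have huc := hu.continuous
  have hφc := hφ.continuous
  have hφi : Integrable φ := hφc.integrable_of_hasCompactSupport hc
  obtain ⟨R, -, h0⟩ := hc.exists_eq_zero_of_lt_norm
  obtain ⟨A, hA0, hA⟩ := hu.exists_abs_second_difference_le R δ
  have hS : ∀ ε : ℝ, MeasurableSet {p : Eucl n × Eucl n | ε < ‖p.1 - p.2‖} := fun ε =>
    measurableSet_lt measurable_const (by fun_prop)
  set F : ℝ → Eucl n × Eucl n → ℝ := fun ε => {p : Eucl n × Eucl n | ε < ‖p.1 - p.2‖}.indicator
    fun p => φ p.1 * ((u p.2 - u p.1) * J (p.1 - p.2)) with hF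
  have hFi : ∀ ε, 0 < ε → Integrable (F ε) := by
    intro ε hε
    refine (hJ.integrable_fst_mul (hφi.abs.mul_const (2 * M / ε ^ 2))).mono' ?_
      (Eventually.of_forall fun p => ?_)
    · have := hJ.measurable_sub
      refine (Measurable.indicator ?_ (hS ε)).aestronglyMeasurable
      exact (hφc.measurable.comp measurable_fst).mul (Measurable.mul (by fun_prop) this)
    · have hJz := hJ.nonneg (p.1 - p.2)
      by_cases hp : ε < ‖p.1 - p.2‖
      · rw [hF]
        simp only
        rw [indicator_of_mem (by exact hp), norm_mul, norm_mul, Real.norm_eq_abs, Real.norm_eq_abs,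
          Real.norm_of_nonneg hJz]
        have h1 : |u p.2 - u p.1| ≤ 2 * M / ε ^ 2 * ‖p.1 - p.2‖ ^ 2 :=
          calc _ ≤ 2 * M := (abs_sub _ _).trans (by linarith [hM p.1, hM p.2])
            _ = 2 * M / ε ^ 2 * ε ^ 2 := by field_simp
            _ ≤ _ := by gcongr
        calc _ ≤ |φ p.1| * (2 * M / ε ^ 2 * ‖p.1 - p.2‖ ^ 2 * J (p.1 - p.2)) := by gcongr
          _ = _ := by ring
      · rw [hF]
        simp only
        rw [indicator_of_notMem (by exact hp)]
        simp only [norm_zero]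
        positivity
  have hFx : ∀ ε x, ∫ y, F ε (x, y) =
      φ x * ∫ y in {y | ε < ‖x - y‖}, (u y - u x) * J (x - y) := by
    intro ε x
    have hmeas : MeasurableSet {y : Eucl n | ε < ‖x - y‖} :=
      measurableSet_lt measurable_const (measurable_const.sub measurable_id).norm
    rw [← integral_const_mul, ← integral_indicator hmeas]
    exact integral_congr_ae (Eventually.of_forall fun y => by simp [hF, indicator])
  have lim1 : Tendsto (fun ε => ∫ p, F ε p) (𝓝[>] 0) (𝓝 (∫ x, φ x * ℓ x)) := by
    have : ∀ᶠ ε in 𝓝[>] (0 : ℝ), ∫ x, ∫ y, F ε (x, y) = ∫ p, F ε p := by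
      filter_upwards [self_mem_nhdsWithin] with ε hε
      rw [Measure.volume_eq_prod, integral_prod _ (hFi ε hε)]
    refine Tendsto.congr' this ?_
    refine tendsto_integral_filter_of_dominated_convergence
      (fun x => |φ x| * (A * ∫ z, ‖z‖ ^ 2 * J z)) ?_ ?_ (hφi.abs.mul_const _) ?_
    · filter_upwards [self_mem_nhdsWithin] with ε hε
      exact (hFi ε hε).integral_prod_left.aestronglyMeasurable
    · filter_upwards [self_mem_nhdsWithin] with ε hε
      refine Eventually.of_forall fun x => ?_
      rw [hFx, norm_mul, Real.norm_eq_abs]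
      by_cases hx : ‖x‖ ≤ R
      · gcongr
        exact hJ.abs_truncated_integral_le hM huc.measurable (fun z hz => hA x z hx hz) hε
      · simp [h0 x (not_le.1 hx)]
    · refine Eventually.of_forall fun x => ?_
      simp only [hFx]
      exact (hℓ x).2.const_mul _
  have hP := integrable_pairDensity hJ (hu.of_le (by norm_num)) hφ hc
  have hsym : ∀ᶠ ε in 𝓝[>] (0 : ℝ), -(1 / 2) *
      ∫ p, {p : Eucl n × Eucl n | ε < ‖p.1 - p.2‖}.indicator (pairDensity J u φ) p =
        ∫ p, F ε p := by
    filter_upwards [self_mem_nhdsWithin] with ε hε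
    have e1 : ∫ p : Eucl n × Eucl n, F ε p.swap = ∫ p, F ε p := by
      rw [Measure.volume_eq_prod, integral_prod_swap]
    have e2 : ∫ p : Eucl n × Eucl n, (F ε p + F ε p.swap) = 2 * ∫ p, F ε p := by
      have hs : Integrable fun p : Eucl n × Eucl n => F ε p.swap := (hFi ε hε).swap
      rw [integral_add (hFi ε hε) hs, e1]
      ring
    have e3 : ∫ p : Eucl n × Eucl n, (F ε p + F ε p.swap) =
        -∫ p, {p : Eucl n × Eucl n | ε < ‖p.1 - p.2‖}.indicator (pairDensity J u φ) p := by
      rw [← integral_neg]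
      refine integral_congr_ae (Eventually.of_forall fun p => ?_)
      simp only [hF, indicator, mem_ofPred_eq, Prod.fst_swap, Prod.snd_swap, norm_sub_rev p.2 p.1,
        hJ.symm p.1 p.2, pairDensity]
      split_ifs
      · ring
      · simp
    linarith
  have lim2 : Tendsto (fun ε => ∫ p, F ε p) (𝓝[>] 0)
      (𝓝 (-(1 / 2) * ∫ p, pairDensity J u φ p)) := by
    refine Tendsto.congr' hsym (Tendsto.const_mul _ ?_)
    refine tendsto_integral_filter_of_dominated_convergence (fun p => ‖pairDensity J u φ p‖)
      (Eventually.of_forall fun ε => (hP.aestronglyMeasurable.indicator (hS ε)))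
      (Eventually.of_forall fun ε => Eventually.of_forall fun p => norm_indicator_le_norm_self _ _)
      hP.norm (Eventually.of_forall fun p => ?_)
    by_cases hp : p.1 = p.2
    · have : pairDensity J u φ p = 0 := by simp [pairDensity, hp]
      simp [indicator, this]
    · refine tendsto_const_nhds.congr' ?_
      have : 0 < ‖p.1 - p.2‖ := norm_pos_iff.2 (sub_ne_zero.2 hp)
      filter_upwards [Ioo_mem_nhdsGT this] with ε hε
      rw [indicator_of_mem (by exact hε.2)]
  exact tendsto_nhds_unique lim1 lim2

theorem integral_pderiv_mul_pderiv {a φ : Eucl n → ℝ} (i : Fin n) (ha : ContDiff ℝ 2 a)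
    (hφ : ContDiff ℝ 1 φ) (hc : HasCompactSupport φ) :
    ∫ x, pderiv i a x * pderiv i φ x = -∫ x, pderiv i (pderiv i a) x * φ x := by
  have h1 := contDiff_pderiv (i := i) ha
  refine integral_mul_fderiv_eq_neg_fderiv_mul_of_integrable ?_ ?_ ?_
    (fun x _ => h1.differentiable one_ne_zero x) (fun x _ => hφ.differentiable one_ne_zero x)
  · exact ((continuous_pderiv h1).mul hφ.continuous).integrable_of_hasCompactSupport hc.mul_left
  · exact (h1.continuous.mul (continuous_pderiv hφ)).integrable_of_hasCompactSupport
      (hasCompactSupport_pderiv hc).mul_left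
  · exact (h1.continuous.mul hφ.continuous).integrable_of_hasCompactSupport hc.mul_left

/-- `g` is the source of `a`: `-Δa - c L[a] = g` in the weak sense. -/
def IsWeakSolution (J : Eucl n → ℝ) (c : ℝ) (a g : Eucl n → ℝ) : Prop :=
  ∀ φ : Eucl n → ℝ, ContDiff ℝ 1 φ → HasCompactSupport φ →
    (∑ i, ∫ x, pderiv i a x * pderiv i φ x) + c / 2 * ∫ p, pairDensity J a φ p =
      ∫ x, g x * φ x

theorem IsSolution.isWeakSolution (hJ : IsTruncatedKernel J δ) {c : ℝ} (hc : c ≠ 0) {f : ℝ → ℝ}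
    (hf : Continuous f) {u : Eucl n → ℝ} {M : ℝ} (hM : ∀ x, |u x| ≤ M) (h : IsSolution J c f u) :
    IsWeakSolution J c u fun x => f (u x) := by
  intro φ hφ hφc
  have hu := h.contDiff
  have huc := hu.continuous
  choose ℓ hℓ heq using h.equation
  have hi : ∀ i, Integrable fun x => pderiv i (pderiv i u) x * φ x := fun i =>
    ((continuous_pderiv (contDiff_pderiv hu)).mul hφ.continuous).integrable_of_hasCompactSupport
      hφc.mul_left
  have hfi : Integrable fun x => f (u x) * φ x :=
    ((hf.comp huc).mul hφ.continuous).integrable_of_hasCompactSupport hφc.mul_left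
  -- Since `c ≠ 0`, the equation itself exhibits `ℓ` as a continuous function, so its integrability
  -- against `φ` comes for free.
  have e : ∀ x, φ x * ℓ x =
      -(1 / c) * ((∑ i, pderiv i (pderiv i u) x * φ x) + f (u x) * φ x) := by
    intro x
    have := heq x
    rw [laplacian_eq_sum_pderiv hu] at this
    have hℓ' : ℓ x = -(1 / c) * ((∑ i, pderiv i (pderiv i u) x) + f (u x)) := by
      field_simp
      linarith
    rw [hℓ', ← Finset.sum_mul]
    ring
  have h1 := hJ.integral_nonlocal_mul hM hu hℓ hφ hφc
  simp_rw [e] at h1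
  rw [integral_const_mul, integral_add (integrable_finsetSum _ fun i _ => hi i) hfi,
    integral_finsetSum _ fun i _ => hi i] at h1
  simp_rw [integral_pderiv_mul_pderiv _ hu hφ hφc]
  rw [Finset.sum_neg_distrib]
  field_simp at h1
  linarith

end weak

/-! ### The linearized equation for directional derivatives -/

section linearized

variable {n : ℕ} {J : Eucl n → ℝ} {δ : ℝ}

theorem hasDerivAt_translate {G : Eucl n → ℝ} (hG : Differentiable ℝ G) (x e : Eucl n) (h : ℝ) :
    HasDerivAt (fun h : ℝ => G (x + h • e)) (fderiv ℝ G (x + h • e) e) h := by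
  have h1 : HasDerivAt (fun h : ℝ => x + h • e) e h := by
    simpa using ((hasDerivAt_id h).smul_const e).const_add x
  exact (hG (x + h • e)).hasFDerivAt.comp_hasDerivAt h h1

theorem norm_add_smul_le {R : ℝ} {x e : Eucl n} {h : ℝ} (hx : ‖x‖ ≤ R)
    (hh : h ∈ Metric.ball (0 : ℝ) 1) : ‖x + h • e‖ ≤ R + ‖e‖ := by
  have h1 : |h| ≤ 1 := by simpa using (mem_ball_zero_iff.1 hh).le
  calc ‖x + h • e‖ ≤ ‖x‖ + |h| * ‖e‖ := by
        simpa [norm_smul] using norm_add_le x (h • e)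
    _ ≤ R + 1 * ‖e‖ := by gcongr
    _ = _ := by rw [one_mul]

/-- The weak equation is differentiated along translations rather than pointwise, because `u` is
only `C²` and third derivatives need not exist. -/
theorem hasDerivAt_integral_translate_mul {G ψ : Eucl n → ℝ} (hG : ContDiff ℝ 1 G)
    (hψ : Continuous ψ) (hc : HasCompactSupport ψ) (e : Eucl n) :
    HasDerivAt (fun h : ℝ => ∫ x, G (x + h • e) * ψ x) (∫ x, fderiv ℝ G x e * ψ x) 0 := by
  obtain ⟨R, -, h0⟩ := hc.exists_eq_zero_of_lt_norm
  have hGd : Continuous fun x => fderiv ℝ G x e :=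
    (hG.continuous_fderiv one_ne_zero).clm_apply continuous_const
  obtain ⟨A, hA⟩ := (isCompact_closedBall (0 : Eucl n) (R + ‖e‖)).exists_bound_of_continuousOn
    hGd.continuousOn
  have hGc := hG.continuous
  have main := (hasDerivAt_integral_of_dominated_loc_of_deriv_le (μ := (volume : Measure (Eucl n)))
    (bound := fun x => A * |ψ x|) (F := fun (h : ℝ) x => G (x + h • e) * ψ x)
    (F' := fun (h : ℝ) x => fderiv ℝ G (x + h • e) e * ψ x) (x₀ := (0 : ℝ))
    (Metric.ball_mem_nhds (0 : ℝ) one_pos) ?_ ?_ ?_ ?_ ?_ ?_).2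
  · simpa using main
  · exact Eventually.of_forall fun h => by fun_prop
  · exact Continuous.integrable_of_hasCompactSupport (by fun_prop) hc.mul_left
  · simp only [zero_smul, add_zero]
    exact (hGd.mul hψ).aestronglyMeasurable
  · refine Eventually.of_forall fun x h hh => ?_
    rw [norm_mul, Real.norm_eq_abs (ψ x)]
    by_cases hx : ‖x‖ ≤ R
    · gcongr
      exact hA _ (by simpa using norm_add_smul_le hx hh)
    · simp [h0 x (not_le.1 hx)]
  · exact (hψ.integrable_of_hasCompactSupport hc).abs.const_mul A
  · exact Eventually.of_forall fun x h _ =>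
      (hasDerivAt_translate (hG.differentiable one_ne_zero) x e h).mul_const _

theorem hasDerivAt_integral_pairDensity_translate (hJ : IsTruncatedKernel J δ) {u φ : Eucl n → ℝ}
    (hu : ContDiff ℝ 2 u) (hφ : ContDiff ℝ 1 φ) (hc : HasCompactSupport φ) (e : Eucl n) :
    HasDerivAt (fun h : ℝ => ∫ p, pairDensity J (fun x => u (x + h • e)) φ p)
      (∫ p, pairDensity J (fun x => fderiv ℝ u x e) φ p) 0 := by
  obtain ⟨R, -, h0⟩ := hc.exists_eq_zero_of_lt_norm
  have hv : ContDiff ℝ 1 fun x => fderiv ℝ u x e :=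
    (hu.fderiv_right (m := 1) (by norm_num)).clm_apply contDiff_const
  obtain ⟨A, hA, hA'⟩ := hv.exists_abs_sub_le_on_ball (R + δ + ‖e‖)
  obtain ⟨B, hB, hB'⟩ := hφ.exists_abs_sub_le hc
  have hu1 : ∀ h : ℝ, ContDiff ℝ 1 fun x => u (x + h • e) := fun h =>
    (hu.of_le (by norm_num)).comp (contDiff_id.add contDiff_const)
  have main := (hasDerivAt_integral_of_dominated_loc_of_deriv_le
    (μ := (volume : Measure (Eucl n × Eucl n)))
    (bound := fun p => ballConst n (R + δ) (A * B) p.1 * (‖p.1 - p.2‖ ^ 2 * J (p.1 - p.2)))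
    (F := fun (h : ℝ) p => pairDensity J (fun x => u (x + h • e)) φ p)
    (F' := fun (h : ℝ) p => pairDensity J (fun x => fderiv ℝ u (x + h • e) e) φ p) (x₀ := (0 : ℝ))
    (Metric.ball_mem_nhds (0 : ℝ) one_pos) ?_ ?_ ?_ ?_ ?_ ?_).2
  · simpa using main
  · exact Eventually.of_forall fun h =>
      (integrable_pairDensity hJ (hu1 h) hφ hc).aestronglyMeasurable
  · exact integrable_pairDensity hJ (hu1 0) hφ hc
  · simp only [zero_smul, add_zero]
    exact (integrable_pairDensity hJ hv hφ hc).aestronglyMeasurable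
  · refine Eventually.of_forall fun p h hh => hJ.norm_mul_le fun hp =>
      abs_sub_mul_sub_le hA hB h0 (hB' _ _) (fun hx hy => ?_) rfl hp
    simpa using hA' _ _ (norm_add_smul_le hx hh) (norm_add_smul_le hy hh)
  · exact hJ.integrable_fst_mul (integrable_ballConst _ _)
  · refine Eventually.of_forall fun p h _ => ?_
    have hd := hu.differentiable two_ne_zero
    exact (((hasDerivAt_translate hd p.1 e h).sub (hasDerivAt_translate hd p.2 e h)).mul_const
      _).mul_const _

theorem IsWeakSolution.translate {c : ℝ} {a g : Eucl n → ℝ} (h : IsWeakSolution J c a g)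
    (k : Eucl n) : IsWeakSolution J c (fun x => a (x + k)) fun x => g (x + k) := by
  intro φ hφ hc
  have hφk : ContDiff ℝ 1 fun x => φ (x - k) := hφ.comp (contDiff_id.sub contDiff_const)
  have hck : HasCompactSupport fun x => φ (x - k) := by
    simpa [sub_eq_add_neg, Function.comp_def] using hc.comp_homeomorph (Homeomorph.addRight (-k))
  have : (volume : Measure (Eucl n × Eucl n)).IsAddRightInvariant := by
    rw [Measure.volume_eq_prod]
    infer_instance
  have h1 := h _ hφk hck
  have e1 : ∀ (b : Eucl n → ℝ) (i : Fin n) (x : Eucl n),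
      pderiv i (fun y => b (y + k)) x = pderiv i b (x + k) := by
    intro b i x
    simp only [pderiv, fderiv_comp_add_right]
  have e2 : ∀ i x, pderiv i (fun y => φ (y - k)) (x + k) = pderiv i φ x := by
    intro i x
    rw [← e1]
    simp
  rw [← integral_add_right_eq_self (fun x => g x * φ (x - k)) k,
    ← integral_add_right_eq_self (pairDensity J a fun x => φ (x - k)) (k, k)] at h1
  have e3 : ∀ i, ∫ x, pderiv i a x * pderiv i (fun x => φ (x - k)) x =
      ∫ x, pderiv i (fun y => a (y + k)) x * pderiv i φ x := by
    intro i
    rw [← integral_add_right_eq_self _ k]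
    simp only [e1, e2]
  simp only [e3] at h1
  simpa [pairDensity] using h1

theorem pderiv_fderiv_apply {u : Eucl n → ℝ} (hu : ContDiff ℝ 2 u) (i : Fin n) (x e : Eucl n) :
    pderiv i (fun y => fderiv ℝ u y e) x = fderiv ℝ (pderiv i u) x e := by
  have h : DifferentiableAt ℝ (fderiv ℝ u) x :=
    (hu.fderiv_right (m := 1) (by norm_num)).differentiable one_ne_zero x
  have hs := (hu.contDiffAt (x := x)).isSymmSndFDerivAt (by simp)
  unfold pderiv
  rw [fderiv_clm_apply h (differentiableAt_const _), fderiv_clm_apply h (differentiableAt_const _)]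
  simpa using hs _ _

/-- Directional derivatives of a solution solve the linearized equation. -/
theorem IsWeakSolution.fderiv_apply (hJ : IsTruncatedKernel J δ) {c : ℝ} {f : ℝ → ℝ}
    (hf : ContDiff ℝ 1 f) {u : Eucl n → ℝ} (hu : ContDiff ℝ 2 u)
    (h : IsWeakSolution J c u fun x => f (u x)) (e : Eucl n) :
    IsWeakSolution J c (fun x => fderiv ℝ u x e) fun x => deriv f (u x) * fderiv ℝ u x e := by
  intro φ hφ hc
  have hu1 : ContDiff ℝ 1 u := hu.of_le (by norm_num)
  have d1 : HasDerivAt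
      (fun h : ℝ => (∑ i, ∫ x, pderiv i u (x + h • e) * pderiv i φ x) +
        c / 2 * ∫ p, pairDensity J (fun x => u (x + h • e)) φ p)
      ((∑ i, ∫ x, fderiv ℝ (pderiv i u) x e * pderiv i φ x) +
        c / 2 * ∫ p, pairDensity J (fun x => fderiv ℝ u x e) φ p) 0 :=
    (HasDerivAt.fun_sum fun i _ => hasDerivAt_integral_translate_mul (contDiff_pderiv hu)
      (continuous_pderiv hφ) (hasCompactSupport_pderiv hc) e).add
      ((hasDerivAt_integral_pairDensity_translate hJ hu hφ hc e).const_mul _)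
  have d2 := hasDerivAt_integral_translate_mul (hf.comp hu1) hφ.continuous hc e
  have e1 : ∀ x, fderiv ℝ (f ∘ u) x e = deriv f (u x) * fderiv ℝ u x e := by
    intro x
    rw [fderiv_comp x (hf.differentiable one_ne_zero _) (hu1.differentiable one_ne_zero _)]
    simp [mul_comm]
  simp only [e1] at d2
  simp only [pderiv_fderiv_apply hu]
  -- By translation invariance of the equation, `d1` and `d2` differentiate the same function of the
  -- shift.
  refine d1.unique (d2.congr_of_eventuallyEq (Eventually.of_forall fun t => ?_))
  have := h.translate (t • e) φ hφ hc
  simpa [pderiv, fderiv_comp_add_right] using this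

end linearized

/-! ### Energy identities for localized solutions -/

section energy

variable {n : ℕ} {J : Eucl n → ℝ} {δ c : ℝ}

theorem HasCompactSupport.fun_sq {a : Eucl n → ℝ} (ha : HasCompactSupport a) :
    HasCompactSupport fun x => a x ^ 2 :=
  ha.comp_left (g := fun r : ℝ => r ^ 2) (by simp)

theorem integral_eq_add_mul_add_mul {X : Type*} [MeasurableSpace X] {μ : Measure X}
    {F A B C : X → ℝ} {s r : ℝ} (hA : Integrable A μ) (hB : Integrable B μ) (hC : Integrable C μ)
    (h : ∀ x, F x = A x + s * B x + r * C x) :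
    ∫ x, F x ∂μ = (∫ x, A x ∂μ) + s * (∫ x, B x ∂μ) + r * ∫ x, C x ∂μ := by
  have hAB : Integrable (fun x => A x + s * B x) μ := hA.add (hB.const_mul _)
  simp only [h]
  rw [integral_add hAB (hC.const_mul _), integral_add hA (hB.const_mul _), integral_const_mul,
    integral_const_mul]

/-- The energy `∫ |∇a|² + (c/2) ∬ (a(x) - a(y))² J(x - y)`. -/
noncomputable def energy (J : Eucl n → ℝ) (c : ℝ) (a : Eucl n → ℝ) : ℝ :=
  (∑ i, ∫ x, pderiv i a x ^ 2) + c / 2 * ∫ p, pairDensity J a a p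

/-- The second variation `energy a - ∫ w a²`. -/
noncomputable def secondVariation (J : Eucl n → ℝ) (c : ℝ) (w a : Eucl n → ℝ) : ℝ :=
  energy J c a - ∫ x, w x * a x ^ 2

/-- The pair integrand of the energy of a cutoff `η` weighted by `v`. -/
def weightedDensity (J v η : Eucl n → ℝ) (p : Eucl n × Eucl n) : ℝ :=
  v p.1 * v p.2 * (η p.1 - η p.2) ^ 2 * J (p.1 - p.2)

/-- The energy `∫ v² |∇η|² + (c/2) ∬ v(x) v(y) (η(x) - η(y))² J(x - y)`. -/
noncomputable def weightedEnergy (J : Eucl n → ℝ) (c : ℝ) (v η : Eucl n → ℝ) : ℝ :=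
  (∑ i, ∫ x, v x ^ 2 * pderiv i η x ^ 2) + c / 2 * ∫ p, weightedDensity J v η p

/-- Nonlocal counterpart of `v² |∇η|² = |∇(vη)|² - ∇v · ∇(vη²)`. -/
theorem weightedDensity_eq (v η : Eucl n → ℝ) (p : Eucl n × Eucl n) :
    weightedDensity J v η p = pairDensity J (fun x => v x * η x) (fun x => v x * η x) p -
      pairDensity J v (fun x => v x * η x ^ 2) p := by
  simp only [weightedDensity, pairDensity]
  ring

theorem integrable_weightedDensity (hJ : IsTruncatedKernel J δ) {v η : Eucl n → ℝ}
    (hv : ContDiff ℝ 1 v) (hη : ContDiff ℝ 1 η) (hc : HasCompactSupport η) :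
    Integrable (weightedDensity J v η) := by
  have h1 := integrable_pairDensity hJ (hv.mul hη) (hv.mul hη) hc.mul_left
  have h2 : Integrable (pairDensity J v fun x => v x * η x ^ 2) :=
    integrable_pairDensity hJ hv (hv.mul (hη.pow 2)) hc.fun_sq.mul_left
  exact (h1.sub h2).congr (Eventually.of_forall fun p => (weightedDensity_eq v η p).symm)

theorem integrable_sq_mul_pderiv_sq {v η : Eucl n → ℝ} (i : Fin n)
    (hv : Continuous v) (hη : ContDiff ℝ 1 η) (hc : HasCompactSupport η) :
    Integrable fun x => v x ^ 2 * pderiv i η x ^ 2 :=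
  ((hv.pow 2).mul ((continuous_pderiv hη).pow 2)).integrable_of_hasCompactSupport
    (hasCompactSupport_pderiv hc).fun_sq.mul_left

theorem integrable_pderiv_mul {a b : Eucl n → ℝ} (i : Fin n)
    (ha : ContDiff ℝ 1 a) (hb : ContDiff ℝ 1 b) (hc : HasCompactSupport b) :
    Integrable fun x => pderiv i a x * pderiv i b x :=
  ((continuous_pderiv ha).mul (continuous_pderiv hb)).integrable_of_hasCompactSupport
    (hasCompactSupport_pderiv hc).mul_left

theorem integrable_pderiv_sq {a : Eucl n → ℝ} (i : Fin n)
    (ha : ContDiff ℝ 1 a) (hc : HasCompactSupport a) :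
    Integrable fun x => pderiv i a x ^ 2 := by
  simpa only [sq] using integrable_pderiv_mul i ha ha hc

/-- Testing the equation of `v` with `v η²`. -/
theorem IsWeakSolution.energy_mul (hJ : IsTruncatedKernel J δ) {v g η : Eucl n → ℝ}
    (h : IsWeakSolution J c v g) (hv : ContDiff ℝ 1 v) (hη : ContDiff ℝ 1 η)
    (hc : HasCompactSupport η) :
    energy J c (fun x => v x * η x) = weightedEnergy J c v η + ∫ x, g x * (v x * η x ^ 2) := by
  have hvη : ContDiff ℝ 1 fun x => v x * η x := hv.mul hη
  have hη2 : ContDiff ℝ 1 fun x => η x ^ 2 := hη.pow 2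
  have hvη2 : ContDiff ℝ 1 fun x => v x * η x ^ 2 := hv.mul hη2
  have hcη : HasCompactSupport fun x => v x * η x := hc.mul_left
  have hcη2 : HasCompactSupport fun x => v x * η x ^ 2 :=
    hc.fun_sq.mul_left
  have h1 := h _ hvη2 hcη2
  have hloc : ∀ i, ∫ x, pderiv i (fun x => v x * η x) x ^ 2 =
      (∫ x, v x ^ 2 * pderiv i η x ^ 2) + ∫ x, pderiv i v x * pderiv i (fun x => v x * η x ^ 2) x := by
    intro i
    rw [← integral_add (integrable_sq_mul_pderiv_sq i hv.continuous hη hc)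
      (integrable_pderiv_mul i hv hvη2 hcη2)]
    refine integral_congr_ae (Eventually.of_forall fun x => ?_)
    have e : pderiv i (fun x => η x ^ 2) x = 2 * η x * pderiv i η x := by
      have := pderiv_mul (i := i) hη hη x
      simp only [← sq] at this
      rw [this]
      ring
    simp only [pderiv_mul hv hη, pderiv_mul hv hη2, e]
    ring
  have hpair : ∫ p, pairDensity J (fun x => v x * η x) (fun x => v x * η x) p =
      (∫ p, weightedDensity J v η p) + ∫ p, pairDensity J v (fun x => v x * η x ^ 2) p := by
    rw [← integral_add (integrable_weightedDensity hJ hv hη hc)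
      (integrable_pairDensity hJ hv hvη2 hcη2)]
    refine integral_congr_ae (Eventually.of_forall fun p => ?_)
    simp only [weightedDensity_eq]
    ring
  rw [energy, weightedEnergy, hpair, ← h1]
  simp only [hloc, Finset.sum_add_distrib]
  ring

theorem IsTruncatedKernel.integral_congr_of_norm_le (hJ : IsTruncatedKernel J δ)
    {F G : Eucl n × Eucl n → ℝ}
    (h : ∀ p : Eucl n × Eucl n, ‖p.1 - p.2‖ ≤ δ → F p = G p) :
    ∫ p : Eucl n × Eucl n, F p * J (p.1 - p.2) = ∫ p : Eucl n × Eucl n, G p * J (p.1 - p.2) := by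
  refine integral_congr_ae (Eventually.of_forall fun p => ?_)
  by_cases hp : ‖p.1 - p.2‖ ≤ δ
  · simp only [h p hp]
  · simp [hJ.range _ (not_le.1 hp)]

/-- The energy of a localized solution perturbed inside the set where the cutoff is `1`. -/
theorem IsWeakSolution.energy_mul_add (hJ : IsTruncatedKernel J δ) {v g η ψ : Eucl n → ℝ} {R : ℝ}
    (h : IsWeakSolution J c v g) (hv : ContDiff ℝ 1 v) (hη : ContDiff ℝ 1 η)
    (hc : HasCompactSupport η) (hψ : ContDiff ℝ 1 ψ) (hcψ : HasCompactSupport ψ)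
    (h1 : ∀ x, ‖x‖ ≤ R + δ → η x = 1) (h0 : ∀ x, R < ‖x‖ → ψ x = 0) (t : ℝ) :
    energy J c (fun x => v x * η x + t * ψ x) =
      energy J c (fun x => v x * η x) + 2 * t * (∫ x, g x * ψ x) + t ^ 2 * energy J c ψ := by
  have hvη : ContDiff ℝ 1 fun x => v x * η x := hv.mul hη
  have htψ : ContDiff ℝ 1 fun x => t * ψ x := contDiff_const.mul hψ
  have hcη : HasCompactSupport fun x => v x * η x := hc.mul_left
  have hδ := hJ.pos
  have hloc : ∀ i, ∫ x, pderiv i (fun x => v x * η x + t * ψ x) x ^ 2 =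
      (∫ x, pderiv i (fun x => v x * η x) x ^ 2) +
        2 * t * (∫ x, pderiv i v x * pderiv i ψ x) + t ^ 2 * ∫ x, pderiv i ψ x ^ 2 := by
    intro i
    have i1 := integrable_pderiv_sq i hvη hcη
    have i2 := integrable_pderiv_mul i hv hψ hcψ
    have i3 := integrable_pderiv_sq i hψ hcψ
    refine integral_eq_add_mul_add_mul i1 i2 i3 fun x => ?_
    simp only [pderiv_add hvη htψ, pderiv_const_mul hψ]
    -- On the support of `ψ` the cutoff is locally constant 1, so the cross term is that of `v`
    -- itself.
    have key : pderiv i (fun x => v x * η x) x * pderiv i ψ x = pderiv i v x * pderiv i ψ x := by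
      by_cases hx : R < ‖x‖
      · have : pderiv i ψ x = 0 := pderiv_eq_zero_of_eventually_const (k := 0) <| by
          filter_upwards [(isOpen_lt continuous_const continuous_norm).mem_nhds hx] with y hy
          exact h0 y hy
        simp [this]
      · have hx' : ‖x‖ < R + δ := by linarith
        have : pderiv i η x = 0 := pderiv_eq_zero_of_eventually_const (k := 1) <| by
          filter_upwards [(isOpen_lt continuous_norm continuous_const).mem_nhds hx'] with y hy
          exact h1 y (le_of_lt hy)
        rw [pderiv_mul hv hη, this, h1 x hx'.le]
        ring
    linear_combination (2 * t) * key
  have hpair : ∫ p, pairDensity J (fun x => v x * η x + t * ψ x) (fun x => v x * η x + t * ψ x) p =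
      (∫ p, pairDensity J (fun x => v x * η x) (fun x => v x * η x) p) +
        2 * t * (∫ p, pairDensity J v ψ p) + t ^ 2 * ∫ p, pairDensity J ψ ψ p := by
    have i1 := integrable_pairDensity hJ hvη hvη hcη
    have i2 := integrable_pairDensity hJ hvη hψ hcψ
    have i3 := integrable_pairDensity hJ hψ hψ hcψ
    -- The margin `δ` in `h1` is used here: a point interacting with `B_R` stays in the set where `η
    -- = 1`.
    have e : ∫ p, pairDensity J v ψ p = ∫ p, pairDensity J (fun x => v x * η x) ψ p := by
      refine hJ.integral_congr_of_norm_le fun p hp => ?_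
      by_cases hx : ‖p.1‖ ≤ R ∨ ‖p.2‖ ≤ R
      · have hn1 : ‖p.1‖ ≤ ‖p.2‖ + ‖p.1 - p.2‖ := norm_le_insert' p.1 p.2
        have hn2 : ‖p.2‖ ≤ ‖p.1‖ + ‖p.1 - p.2‖ := norm_le_insert p.1 p.2
        simp only
        rw [h1 p.1 (by rcases hx with h | h <;> linarith),
          h1 p.2 (by rcases hx with h | h <;> linarith)]
        ring
      · push Not at hx
        rw [h0 _ hx.1, h0 _ hx.2]
        ring
    rw [e]
    refine integral_eq_add_mul_add_mul i1 i2 i3 fun p => ?_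
    simp only [pairDensity]
    ring
  rw [energy, energy, energy, hpair, ← h ψ hψ hcψ]
  simp only [hloc, Finset.sum_add_distrib, ← Finset.mul_sum]
  ring

/-- The term linear in `t` is the weak equation of `v` tested with `ψ`, hence zero. The second
variation at `v η` reduces to the weighted energy for the same reason. -/
theorem IsWeakSolution.secondVariation_mul_add (hJ : IsTruncatedKernel J δ) {v w η ψ : Eucl n → ℝ}
    {R : ℝ} (h : IsWeakSolution J c v fun x => w x * v x) (hw : Continuous w) (hv : ContDiff ℝ 1 v)
    (hη : ContDiff ℝ 1 η) (hc : HasCompactSupport η) (hψ : ContDiff ℝ 1 ψ)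
    (hcψ : HasCompactSupport ψ) (h1 : ∀ x, ‖x‖ ≤ R + δ → η x = 1) (h0 : ∀ x, R < ‖x‖ → ψ x = 0)
    (t : ℝ) :
    secondVariation J c w (fun x => v x * η x + t * ψ x) =
      weightedEnergy J c v η + t ^ 2 * secondVariation J c w ψ := by
  have hvc := hv.continuous
  have hηc := hη.continuous
  have hψc := hψ.continuous
  have i1 : Integrable fun x => w x * v x * (v x * η x ^ 2) :=
    Continuous.integrable_of_hasCompactSupport (by fun_prop)
      hc.fun_sq.mul_left.mul_left
  have i2 : Integrable fun x => w x * v x * ψ x :=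
    Continuous.integrable_of_hasCompactSupport (by fun_prop) hcψ.mul_left
  have i3 : Integrable fun x => w x * ψ x ^ 2 :=
    Continuous.integrable_of_hasCompactSupport (by fun_prop)
      hcψ.fun_sq.mul_left
  have e : ∫ x, w x * (v x * η x + t * ψ x) ^ 2 = (∫ x, w x * v x * (v x * η x ^ 2)) +
      2 * t * (∫ x, w x * v x * ψ x) + t ^ 2 * ∫ x, w x * ψ x ^ 2 := by
    refine integral_eq_add_mul_add_mul i1 i2 i3 fun x => ?_
    have key : η x * ψ x = ψ x := by
      by_cases hx : R < ‖x‖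
      · simp [h0 x hx]
      · rw [h1 x (by linarith [hJ.pos]), one_mul]
    linear_combination (2 * t * w x * v x) * key
  rw [secondVariation, h.energy_mul_add hJ hv hη hc hψ hcψ h1 h0 t, h.energy_mul hJ hv hη hc, e,
    secondVariation]
  ring

end energy

/-! ### Logarithmic cutoffs -/

section cutoff

variable {n : ℕ} {J : Eucl n → ℝ} {δ c : ℝ}

/-- `χ` is a cutoff between the balls of radii `R` and `2R`, with slope at most `L / R`. -/
structure IsCutoff (R L : ℝ) (χ : Eucl n → ℝ) : Prop where
  pos : 0 < R
  nonneg : 0 ≤ L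
  contDiff : ContDiff ℝ 1 χ
  abs_le_one : ∀ x, |χ x| ≤ 1
  one : ∀ x, ‖x‖ ≤ R → χ x = 1
  zero : ∀ x, 2 * R ≤ ‖x‖ → χ x = 0
  lip : ∀ x y, |χ x - χ y| ≤ L / R * ‖x - y‖

theorem exists_isCutoff (n : ℕ) : ∃ L : ℝ, ∀ R : ℝ, 0 < R → ∃ χ : Eucl n → ℝ, IsCutoff R L χ := by
  let b : ContDiffBump (0 : Eucl n) := ⟨1, 2, one_pos, one_lt_two⟩
  have hb : ContDiff ℝ 1 b := b.contDiff
  obtain ⟨L, hL, hL'⟩ := hb.exists_abs_sub_le b.hasCompactSupport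
  refine ⟨L, fun R hR => ⟨fun x => b (R⁻¹ • x), hR, hL, hb.comp (contDiff_const_smul _),
    fun x => ?_, fun x hx => ?_, fun x hx => ?_, fun x y => ?_⟩⟩
  · rw [abs_of_nonneg b.nonneg]
    exact b.le_one
  · refine b.one_of_mem_closedBall ?_
    rw [mem_closedBall_zero_iff, norm_smul, norm_inv, Real.norm_of_nonneg hR.le]
    exact (inv_mul_le_iff₀ hR).2 (by simpa [b] using hx)
  · refine b.zero_of_le_dist ?_
    rw [dist_zero_right, norm_smul, norm_inv, Real.norm_of_nonneg hR.le, le_inv_mul_iff₀ hR]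
    simpa [b, mul_comm] using hx
  · refine (hL' _ _).trans (le_of_eq ?_)
    rw [← smul_sub, norm_smul, norm_inv, Real.norm_of_nonneg hR.le]
    ring

namespace IsCutoff

variable {R R' L L' : ℝ} {χ χ' : Eucl n → ℝ}

theorem hasCompactSupport (h : IsCutoff R L χ) : HasCompactSupport χ := by
  refine HasCompactSupport.intro (isCompact_closedBall 0 (2 * R)) fun x hx => h.zero x ?_
  simpa using (not_le.1 (by simpa using hx : ¬‖x‖ ≤ 2 * R)).le

theorem abs_pderiv_le (h : IsCutoff R L χ) (i : Fin n) (x : Eucl n) : |pderiv i χ x| ≤ L / R :=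
  (_root_.abs_pderiv_le x).trans <| norm_fderiv_le_of_lip' ℝ (div_nonneg h.nonneg h.pos.le)
    (Eventually.of_forall fun y => h.lip y x)

/-- The cutoff attains its maximum 1 at `x`; this argument also covers the boundary sphere. -/
theorem pderiv_eq_zero_of_le (h : IsCutoff R L χ) (i : Fin n) {x : Eucl n} (hx : ‖x‖ ≤ R) :
    pderiv i χ x = 0 := by
  have hmax : IsLocalMax χ x := Eventually.of_forall fun y => by
    rw [h.one x hx]
    exact (le_abs_self _).trans (h.abs_le_one y)
  simp [pderiv, hmax.fderiv_eq_zero]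

theorem pderiv_eq_zero_of_gt (h : IsCutoff R L χ) (i : Fin n) {x : Eucl n} (hx : 2 * R < ‖x‖) :
    pderiv i χ x = 0 :=
  pderiv_eq_zero_of_eventually_const (k := 0) <| by
    filter_upwards [(isOpen_lt continuous_const continuous_norm).mem_nhds hx] with y hy
    exact h.zero y (le_of_lt hy)

theorem pderiv_mul_pderiv_eq_zero (h : IsCutoff R L χ) (h' : IsCutoff R' L' χ')
    (hR : 4 * R ≤ R') (i : Fin n) (x : Eucl n) : pderiv i χ x * pderiv i χ' x = 0 := by
  have := h.pos
  by_cases hx : 2 * R < ‖x‖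
  · rw [h.pderiv_eq_zero_of_gt i hx, zero_mul]
  · rw [h'.pderiv_eq_zero_of_le i (by linarith), mul_zero]

/-- Either both points lie outside `B_{2R}`, or both lie in `B_{2R+2δ} ⊆ B_{4R} ⊆ B_{R'}`:
transition regions a factor 4 apart are not linked by a jump. -/
theorem sub_mul_sub_eq_zero (h : IsCutoff R L χ) (h' : IsCutoff R' L' χ') (hR : 4 * R ≤ R')
    (hδ : δ ≤ R) {x y : Eucl n} (hxy : ‖x - y‖ ≤ δ) : (χ x - χ y) * (χ' x - χ' y) = 0 := by
  have h1 : ‖x‖ ≤ ‖y‖ + ‖x - y‖ := norm_le_insert' x y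
  have h2 : ‖y‖ ≤ ‖x‖ + ‖x - y‖ := norm_le_insert x y
  have := (norm_nonneg _).trans hxy
  by_cases hx : 2 * R + δ ≤ ‖x‖
  · rw [h.zero x (by linarith), h.zero y (by linarith)]
    ring
  · rw [h'.one x (by linarith), h'.one y (by linarith)]
    ring

end IsCutoff

theorem integrable_indicator_sq {v : Eucl n → ℝ} (hv : Continuous v) (r : ℝ) :
    Integrable ((Metric.closedBall (0 : Eucl n) r).indicator fun x => v x ^ 2) :=
  (integrable_indicator_iff Metric.isClosed_closedBall.measurableSet).2
    ((hv.pow 2).continuousOn.integrableOn_compact (isCompact_closedBall 0 r))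

/-- The Lipschitz bound on `χ` and `v(x) v(y) ≤ (v(x)² + v(y)²) / 2` reduce the pair term to `∫ v²`
times the second moment. The radius `3R` accounts for jumps out of `B_{2R}`, as `δ ≤ R`. -/
theorem IsCutoff.weightedEnergy_le (hJ : IsTruncatedKernel J δ) (hc : 0 ≤ c) {R L : ℝ}
    {χ v : Eucl n → ℝ} (h : IsCutoff R L χ) (hδ : δ ≤ R) (hv : ContDiff ℝ 1 v) :
    weightedEnergy J c v χ ≤ (n + c / 2 * ∫ z, ‖z‖ ^ 2 * J z) * (L / R) ^ 2 *
      ∫ x in Metric.closedBall 0 (3 * R), v x ^ 2 := by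
  have hR := h.pos
  have hL : 0 ≤ L / R := div_nonneg h.nonneg hR.le
  rw [← integral_indicator Metric.isClosed_closedBall.measurableSet]
  set g : Eucl n → ℝ := (Metric.closedBall (0 : Eucl n) (3 * R)).indicator fun x => v x ^ 2 with hg
  have hgi : Integrable g := integrable_indicator_sq hv.continuous _
  have hg0 : ∀ x, 0 ≤ g x := fun x => indicator_nonneg (fun y _ => sq_nonneg (v y)) x
  have hgv : ∀ x, ‖x‖ ≤ 3 * R → g x = v x ^ 2 := fun x hx => indicator_of_mem (by simpa using hx) _
  have hloc : ∀ i, ∫ x, v x ^ 2 * pderiv i χ x ^ 2 ≤ (L / R) ^ 2 * ∫ x, g x := by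
    intro i
    rw [← integral_const_mul]
    refine integral_mono (integrable_sq_mul_pderiv_sq i hv.continuous h.contDiff h.hasCompactSupport)
      (hgi.const_mul _) fun x => ?_
    simp only
    by_cases hx : 2 * R < ‖x‖
    · rw [h.pderiv_eq_zero_of_gt i hx]
      have := hg0 x
      have : 0 ≤ (L / R) ^ 2 * g x := by positivity
      simpa using this
    · rw [hgv x (by linarith), mul_comm]
      exact mul_le_mul_of_nonneg_right
        (sq_le_sq.2 (by rw [abs_of_nonneg hL]; exact h.abs_pderiv_le i x)) (sq_nonneg _)
  have hpair : ∫ p, weightedDensity J v χ p ≤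
      (L / R) ^ 2 * ((∫ x, g x) * ∫ z, ‖z‖ ^ 2 * J z) := by
    have i1 := hJ.integrable_fst_mul hgi
    have i2 := hJ.integrable_snd_mul hgi
    have e : (L / R) ^ 2 * ((∫ x, g x) * ∫ z, ‖z‖ ^ 2 * J z) = ∫ p : Eucl n × Eucl n,
        (L / R) ^ 2 / 2 * (g p.1 * (‖p.1 - p.2‖ ^ 2 * J (p.1 - p.2)) +
          g p.2 * (‖p.1 - p.2‖ ^ 2 * J (p.1 - p.2))) := by
      rw [integral_const_mul, integral_add i1 i2, hJ.integral_fst_mul hgi, hJ.integral_snd_mul hgi]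
      ring
    rw [e]
    refine integral_mono (integrable_weightedDensity hJ hv h.contDiff h.hasCompactSupport)
      ((i1.add i2).const_mul _) fun p => ?_
    have hJz := hJ.nonneg (p.1 - p.2)
    have g1 := hg0 p.1
    have g2 := hg0 p.2
    have hnn : 0 ≤ (L / R) ^ 2 / 2 * (g p.1 * (‖p.1 - p.2‖ ^ 2 * J (p.1 - p.2)) +
          g p.2 * (‖p.1 - p.2‖ ^ 2 * J (p.1 - p.2))) := by positivity
    by_cases hp : ‖p.1 - p.2‖ ≤ δ
    · have h1 : ‖p.1‖ ≤ ‖p.2‖ + ‖p.1 - p.2‖ := norm_le_insert' p.1 p.2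
      have h2 : ‖p.2‖ ≤ ‖p.1‖ + ‖p.1 - p.2‖ := norm_le_insert p.1 p.2
      by_cases hx : ‖p.1‖ ≤ 2 * R ∨ ‖p.2‖ ≤ 2 * R
      · rw [hgv p.1 (by rcases hx with h | h <;> linarith),
          hgv p.2 (by rcases hx with h | h <;> linarith)]
        have hs : (χ p.1 - χ p.2) ^ 2 ≤ (L / R) ^ 2 * ‖p.1 - p.2‖ ^ 2 := by
          rw [← mul_pow, ← sq_abs]
          gcongr
          exact h.lip _ _
        have hvv : v p.1 * v p.2 ≤ (v p.1 ^ 2 + v p.2 ^ 2) / 2 := by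
          nlinarith [sq_nonneg (v p.1 - v p.2)]
        calc weightedDensity J v χ p
            ≤ (v p.1 ^ 2 + v p.2 ^ 2) / 2 * ((L / R) ^ 2 * ‖p.1 - p.2‖ ^ 2) * J (p.1 - p.2) := by
              unfold weightedDensity
              gcongr
          _ = _ := by ring
      · push Not at hx
        refine le_of_eq_of_le ?_ hnn
        rw [weightedDensity, h.zero _ hx.1.le, h.zero _ hx.2.le]
        ring
    · refine le_of_eq_of_le ?_ hnn
      rw [weightedDensity, hJ.range _ (not_le.1 hp), mul_zero]
  have hsum : ∑ i : Fin n, ∫ x, v x ^ 2 * pderiv i χ x ^ 2 ≤ n * ((L / R) ^ 2 * ∫ x, g x) := by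
    simpa using Finset.sum_le_sum fun i (_ : i ∈ Finset.univ) => hloc i
  calc weightedEnergy J c v χ
      ≤ n * ((L / R) ^ 2 * ∫ x, g x) +
          c / 2 * ((L / R) ^ 2 * ((∫ x, g x) * ∫ z, ‖z‖ ^ 2 * J z)) := by
        unfold weightedEnergy
        gcongr
    _ = _ := by ring

theorem sq_sum_eq_sum_sq {ι : Type*} [DecidableEq ι] {s : Finset ι} {d : ι → ℝ}
    (h : ∀ j ∈ s, ∀ k ∈ s, j ≠ k → d j * d k = 0) : (∑ k ∈ s, d k) ^ 2 = ∑ k ∈ s, d k ^ 2 := by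
  rw [sq, Finset.sum_mul_sum]
  refine Finset.sum_congr rfl fun j hj => ?_
  rw [Finset.sum_eq_single j (fun k hk hkj => h j hj k hk hkj.symm) (fun hj' => absurd hj hj'), sq]

/-- With pairwise orthogonal gradients and increments, the square of the sum has no cross terms. -/
theorem weightedEnergy_sum_eq (hJ : IsTruncatedKernel J δ) {v : Eucl n → ℝ} (hv : ContDiff ℝ 1 v)
    {ι : Type*} [DecidableEq ι] (s : Finset ι) {χ : ι → Eucl n → ℝ} (r : ℝ)
    (hχ : ∀ k ∈ s, ContDiff ℝ 1 (χ k)) (hcs : ∀ k ∈ s, HasCompactSupport (χ k))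
    (h1 : ∀ j ∈ s, ∀ k ∈ s, j ≠ k → ∀ i x, pderiv i (χ j) x * pderiv i (χ k) x = 0)
    (h2 : ∀ j ∈ s, ∀ k ∈ s, j ≠ k → ∀ x y, ‖x - y‖ ≤ δ →
      (χ j x - χ j y) * (χ k x - χ k y) = 0) :
    weightedEnergy J c v (fun x => r * ∑ k ∈ s, χ k x) =
      r ^ 2 * ∑ k ∈ s, weightedEnergy J c v (χ k) := by
  have hloc : ∀ i, ∫ x, v x ^ 2 * pderiv i (fun x => r * ∑ k ∈ s, χ k x) x ^ 2 =
      r ^ 2 * ∑ k ∈ s, ∫ x, v x ^ 2 * pderiv i (χ k) x ^ 2 := by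
    intro i
    rw [← integral_finsetSum _ fun k hk =>
      integrable_sq_mul_pderiv_sq i hv.continuous (hχ k hk) (hcs k hk), ← integral_const_mul]
    refine integral_congr_ae (Eventually.of_forall fun x => ?_)
    simp only
    rw [pderiv_const_mul (ContDiff.sum hχ), pderiv_sum s hχ, mul_pow,
      sq_sum_eq_sum_sq fun j hj k hk hjk => h1 j hj k hk hjk i x, ← Finset.mul_sum]
    ring
  have hpair : ∫ p, weightedDensity J v (fun x => r * ∑ k ∈ s, χ k x) p =
      r ^ 2 * ∑ k ∈ s, ∫ p, weightedDensity J v (χ k) p := by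
    rw [← integral_finsetSum _ fun k hk => integrable_weightedDensity hJ hv (hχ k hk) (hcs k hk),
      ← integral_const_mul]
    refine integral_congr_ae (Eventually.of_forall fun p => ?_)
    by_cases hp : ‖p.1 - p.2‖ ≤ δ
    · simp only [weightedDensity]
      rw [← mul_sub, ← Finset.sum_sub_distrib, mul_pow,
        sq_sum_eq_sum_sq fun j hj k hk hjk => h2 j hj k hk hjk p.1 p.2 hp, ← Finset.sum_mul,
        ← Finset.mul_sum]
      ring
    · simp [weightedDensity, hJ.range _ (not_le.1 hp)]
  rw [weightedEnergy, hpair]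
  simp only [hloc, weightedEnergy, Finset.sum_add_distrib, ← Finset.mul_sum]
  rw [Finset.sum_comm]
  ring

/-- Under quadratic growth of `∫ v²`, cutoffs of arbitrarily small weighted energy exist. -/
theorem exists_cutoff_weightedEnergy_le (hJ : IsTruncatedKernel J δ) (hc : 0 ≤ c) {v : Eucl n → ℝ}
    (hv : ContDiff ℝ 1 v) {C R₀ : ℝ}
    (hC : ∀ R, R₀ ≤ R → ∫ x in Metric.closedBall 0 R, v x ^ 2 ≤ C * R ^ 2) (ρ : ℝ) {ε : ℝ}
    (hε : 0 < ε) :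
    ∃ η : Eucl n → ℝ, ContDiff ℝ 1 η ∧ HasCompactSupport η ∧ (∀ x, ‖x‖ ≤ ρ → η x = 1) ∧
      weightedEnergy J c v η ≤ ε := by
  obtain ⟨L, hL⟩ := exists_isCutoff n
  set r : ℝ := max (max ρ R₀) δ with hr
  have hδr : δ ≤ r := le_max_right _ _
  have hρr : ρ ≤ r := (le_max_left _ _).trans (le_max_left _ _)
  have hRr : R₀ ≤ r := (le_max_right _ _).trans (le_max_left _ _)
  have hr0 : 0 < r := hJ.pos.trans_le hδr
  have hrad : ∀ k : ℕ, r ≤ r * 4 ^ k := fun k =>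
    le_mul_of_one_le_right hr0.le (one_le_pow₀ (by norm_num))
  choose χ hχ using fun k : ℕ => hL (r * 4 ^ k) (by positivity)
  -- Quadratic growth cancels the factor `R⁻²` of the squared slope, so `D` bounds the energy at
  -- every scale; the 9 comes from the radius `3R`.
  set D : ℝ := (n + c / 2 * ∫ z, ‖z‖ ^ 2 * J z) * L ^ 2 * (9 * C) with hD
  have hE : ∀ k, weightedEnergy J c v (χ k) ≤ D := by
    intro k
    have hRk : 0 < r * 4 ^ k := by positivity
    have hm := hJ.moment_nonneg
    refine ((hχ k).weightedEnergy_le hJ hc (hδr.trans (hrad k)) hv).trans ?_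
    calc _ ≤ (n + c / 2 * ∫ z, ‖z‖ ^ 2 * J z) * (L / (r * 4 ^ k)) ^ 2 *
          (C * (3 * (r * 4 ^ k)) ^ 2) := by
          gcongr
          refine hC _ ?_
          linarith [hrad k]
      _ = D := by
          rw [hD]
          field_simp
          ring
  obtain ⟨N, hN⟩ := exists_nat_gt (D / ε)
  set m : ℕ := N + 1 with hm
  have hm0 : (0 : ℝ) < m := by positivity
  have hmul : ∀ j k : ℕ, j < k → 4 * (r * 4 ^ j) ≤ r * 4 ^ k := by
    intro j k hjk
    have : (4 : ℝ) ^ (j + 1) ≤ 4 ^ k := pow_le_pow_right₀ (by norm_num) hjk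
    rw [pow_succ] at this
    nlinarith
  -- Averaging `m` orthogonal cutoffs at the scales `r 4^k` gives energy at most `m D / m² = D / m`.
  refine ⟨fun x => (1 / m : ℝ) * ∑ k ∈ Finset.range m, χ k x,
    contDiff_const.mul (ContDiff.sum fun k _ => (hχ k).contDiff), ?_, fun x hx => ?_, ?_⟩
  · refine HasCompactSupport.intro (isCompact_closedBall 0 (2 * (r * 4 ^ m))) fun x hx => ?_
    have hx' : 2 * (r * 4 ^ m) < ‖x‖ := not_le.1 (by simpa using hx)
    rw [Finset.sum_eq_zero, mul_zero]
    intro k hk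
    refine (hχ k).zero x (le_trans ?_ hx'.le)
    have : (4 : ℝ) ^ k ≤ 4 ^ m := pow_le_pow_right₀ (by norm_num) (Finset.mem_range.1 hk).le
    gcongr
  · simp only
    rw [Finset.sum_congr rfl fun k _ => (hχ k).one x (hx.trans (hρr.trans (hrad k)))]
    simp only [Finset.sum_const, Finset.card_range, nsmul_eq_mul, mul_one]
    field_simp
  · rw [weightedEnergy_sum_eq hJ hv (Finset.range m) (1 / m : ℝ) (fun k _ => (hχ k).contDiff)
      (fun k _ => (hχ k).hasCompactSupport)]
    · calc _ ≤ (1 / m : ℝ) ^ 2 * ∑ k ∈ Finset.range m, D := by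
            gcongr with k
            exact hE k
        _ = D / m := by
            simp only [Finset.sum_const, Finset.card_range, nsmul_eq_mul]
            field_simp
        _ ≤ ε := by
            rw [div_le_iff₀ hm0]
            rw [div_lt_iff₀ hε] at hN
            have : (m : ℝ) = N + 1 := by simp [hm]
            nlinarith
    · intro j _ k _ hjk i x
      rcases lt_or_gt_of_ne hjk with h | h
      · exact (hχ j).pderiv_mul_pderiv_eq_zero (hχ k) (hmul j k h) i x
      · rw [mul_comm]
        exact (hχ k).pderiv_mul_pderiv_eq_zero (hχ j) (hmul k j h) i x
    · intro j _ k _ hjk x y hxy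
      rcases lt_or_gt_of_ne hjk with h | h
      · exact (hχ j).sub_mul_sub_eq_zero (hχ k) (hmul j k h) (hδr.trans (hrad j)) hxy
      · rw [mul_comm]
        exact (hχ k).sub_mul_sub_eq_zero (hχ j) (hmul k j h) (hδr.trans (hrad k)) hxy

end cutoff

/-! ### Quadratic growth of the gradient; stability tested with absolute values -/

section stable

variable {n : ℕ} {J : Eucl n → ℝ} {δ c : ℝ}

theorem IsTruncatedKernel.integral_pairDensity_self_nonneg (hJ : IsTruncatedKernel J δ)
    (a : Eucl n → ℝ) : 0 ≤ ∫ p, pairDensity J a a p :=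
  integral_nonneg fun _ => mul_nonneg (mul_self_nonneg _) (hJ.nonneg _)

/-- A Caccioppoli estimate: bounded solutions with bounded source have quadratic growth of the
Dirichlet energy in the plane. -/
theorem IsWeakSolution.exists_setIntegral_pderiv_sq_le {J : Eucl 2 → ℝ} (hJ : IsTruncatedKernel J δ)
    (hc : 0 ≤ c) {u g : Eucl 2 → ℝ} (h : IsWeakSolution J c u g) (hu : ContDiff ℝ 1 u)
    (hg : Continuous g) {M G : ℝ} (hM : ∀ x, |u x| ≤ M) (hG : ∀ x, |g x| ≤ G) :
    ∃ C R₀ : ℝ, ∀ R, R₀ ≤ R →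
      ∫ x in Metric.closedBall 0 R, ∑ i, pderiv i u x ^ 2 ≤ C * R ^ 2 := by
  obtain ⟨L, hL⟩ := exists_isCutoff 2
  have hM0 : 0 ≤ M := (abs_nonneg _).trans (hM 0)
  have hG0 : 0 ≤ G := (abs_nonneg _).trans (hG 0)
  set V : ℝ := volume.real (Metric.ball (0 : Eucl 2) 1) with hV
  have hV0 : 0 ≤ V := measureReal_nonneg
  have hvol : ∀ r : ℝ, 0 ≤ r → volume.real (Metric.closedBall (0 : Eucl 2) r) = r ^ 2 * V := by
    intro r hr
    rw [measureReal_def, Measure.addHaar_closedBall _ _ hr, ENNReal.toReal_mul,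
      ENNReal.toReal_ofReal (by positivity)]
    simp [hV, measureReal_def]
  have hm := hJ.moment_nonneg
  set D : ℝ := 2 + c / 2 * ∫ z, ‖z‖ ^ 2 * J z with hD
  have hD0 : 0 ≤ D := by positivity
  refine ⟨D * L ^ 2 * M ^ 2 * 9 * V + G * M * 4 * V, max δ 1, fun R hR => ?_⟩
  have hδR : δ ≤ R := (le_max_left _ _).trans hR
  have hR1 : 1 ≤ R := (le_max_right _ _).trans hR
  have hR0 : 0 < R := by linarith
  obtain ⟨χ, hχ⟩ := hL R hR0
  have huχ : ContDiff ℝ 1 fun x => u x * χ x := hu.mul hχ.contDiff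
  have hcs : HasCompactSupport fun x => u x * χ x := hχ.hasCompactSupport.mul_left
  -- In the plane the weighted energy is bounded uniformly in `R`; the source term, over the area of
  -- `B_{2R}`, produces the factor `R²`.
  have hE := h.energy_mul hJ hu hχ.contDiff hχ.hasCompactSupport
  have h1 : ∫ x in Metric.closedBall 0 R, ∑ i, pderiv i u x ^ 2 ≤
      energy J c fun x => u x * χ x := by
    have hI : Integrable fun x => ∑ i, pderiv i (fun x => u x * χ x) x ^ 2 :=
      integrable_finsetSum _ fun i _ => integrable_pderiv_sq i huχ hcs
    have e1 : ∫ x in Metric.closedBall 0 R, ∑ i, pderiv i u x ^ 2 =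
        ∫ x in Metric.closedBall 0 R, ∑ i, pderiv i (fun x => u x * χ x) x ^ 2 := by
      refine setIntegral_congr_fun Metric.isClosed_closedBall.measurableSet fun x hx => ?_
      have hx' : ‖x‖ ≤ R := by simpa using hx
      refine Finset.sum_congr rfl fun i _ => ?_
      rw [pderiv_mul hu hχ.contDiff, hχ.pderiv_eq_zero_of_le i hx', hχ.one x hx']
      ring
    rw [e1]
    calc _ ≤ ∫ x, ∑ i, pderiv i (fun x => u x * χ x) x ^ 2 :=
          setIntegral_le_integral hI
            (Eventually.of_forall fun x => Finset.sum_nonneg fun i _ => sq_nonneg _)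
      _ = ∑ i, ∫ x, pderiv i (fun x => u x * χ x) x ^ 2 :=
          integral_finsetSum _ fun i _ => integrable_pderiv_sq i huχ hcs
      _ ≤ _ := by
          have := hJ.integral_pairDensity_self_nonneg fun x => u x * χ x
          unfold energy
          have : 0 ≤ c / 2 * ∫ p, pairDensity J (fun x => u x * χ x) (fun x => u x * χ x) p := by
            positivity
          linarith
  have h2 : ∫ x in Metric.closedBall (0 : Eucl 2) (3 * R), u x ^ 2 ≤ M ^ 2 * (9 * R ^ 2 * V) := by
    calc _ ≤ ∫ x in Metric.closedBall (0 : Eucl 2) (3 * R), M ^ 2 := by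
          refine setIntegral_mono
            ((hu.continuous.pow 2).continuousOn.integrableOn_compact (isCompact_closedBall _ _))
            (integrableOn_const measure_closedBall_lt_top.ne) fun x => ?_
          exact sq_le_sq.2 (by rw [abs_of_nonneg hM0]; exact hM x)
      _ = _ := by
          rw [setIntegral_const, hvol _ (by positivity), smul_eq_mul]
          ring
  have h3 : ∫ x, g x * (u x * χ x ^ 2) ≤ G * M * (4 * R ^ 2 * V) := by
    have hcont := hu.continuous
    have hχc := hχ.contDiff.continuous
    calc _ ≤ ∫ x, ballConst 2 (2 * R) (G * M) x := by
          refine integral_mono (Continuous.integrable_of_hasCompactSupport (by fun_prop)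
            hχ.hasCompactSupport.fun_sq.mul_left.mul_left) (integrable_ballConst _ _) fun x => ?_
          by_cases hx : ‖x‖ ≤ 2 * R
          · rw [ballConst_of_le hx]
            refine (le_abs_self _).trans ?_
            rw [abs_mul, abs_mul, abs_pow]
            calc |g x| * (|u x| * |χ x| ^ 2) ≤ G * (M * 1 ^ 2) := by
                  gcongr
                  · exact hG x
                  · exact hM x
                  · exact hχ.abs_le_one x
              _ = G * M := by ring
          · rw [ballConst_of_lt (not_le.1 hx), hχ.zero x (not_le.1 hx).le]
            simp
      _ = _ := by
          rw [ballConst, integral_indicator_const _ Metric.isClosed_closedBall.measurableSet,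
            hvol _ (by positivity), smul_eq_mul]
          ring
  have h4 : weightedEnergy J c u χ ≤ D * L ^ 2 * M ^ 2 * 9 * V * R ^ 2 := by
    refine (hχ.weightedEnergy_le hJ hc hδR hu).trans ?_
    calc _ ≤ D * (L / R) ^ 2 * (M ^ 2 * (9 * R ^ 2 * V)) := by
          rw [hD]
          push_cast
          gcongr
      _ = D * L ^ 2 * M ^ 2 * 9 * V * 1 := by
          field_simp
      _ ≤ _ := by
          gcongr
          exact one_le_pow₀ hR1
  calc _ ≤ _ := h1
    _ = _ := hE
    _ ≤ D * L ^ 2 * M ^ 2 * 9 * V * R ^ 2 + G * M * (4 * R ^ 2 * V) := add_le_add h4 h3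
    _ = _ := by ring

theorem IsStable.secondVariation_nonneg {f : ℝ → ℝ} {u : Eucl n → ℝ} (h : IsStable J c f u)
    {ζ : Eucl n → ℝ} (hζ : ContDiff ℝ 1 ζ) (hcs : HasCompactSupport ζ) :
    0 ≤ secondVariation J c (fun x => deriv f (u x)) ζ := by
  have h1 := h ζ hζ hcs
  simp only [norm_gradient_sq] at h1
  rw [integral_finsetSum _ fun i _ => integrable_pderiv_sq i hζ hcs] at h1
  unfold secondVariation energy pairDensity
  simp only [← sq]
  linarith

/-- A smooth approximation of the absolute value. -/
noncomputable def smoothAbs (ε s : ℝ) : ℝ := √(s ^ 2 + ε ^ 2) - ε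

theorem smoothAbs_zero {ε : ℝ} (hε : 0 < ε) : smoothAbs ε 0 = 0 := by
  simp [smoothAbs, Real.sqrt_sq hε.le]

theorem contDiff_smoothAbs {ε : ℝ} (hε : 0 < ε) : ContDiff ℝ 1 (smoothAbs ε) :=
  (ContDiff.sqrt (by fun_prop) fun s => by positivity).sub contDiff_const

theorem abs_smoothAbs_sub_le (ε s t : ℝ) : |smoothAbs ε s - smoothAbs ε t| ≤ |s - t| := by
  rw [← sq_le_sq]
  have hs := Real.sq_sqrt (by positivity : 0 ≤ s ^ 2 + ε ^ 2)
  have ht := Real.sq_sqrt (by positivity : 0 ≤ t ^ 2 + ε ^ 2)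
  -- Cauchy–Schwarz for the vectors `(s, ε)` and `(t, ε)`.
  have hst : s * t + ε ^ 2 ≤ √(s ^ 2 + ε ^ 2) * √(t ^ 2 + ε ^ 2) := by
    rw [← Real.sqrt_mul (by positivity)]
    refine Real.le_sqrt_of_sq_le ?_
    nlinarith [sq_nonneg (ε * (s - t))]
  unfold smoothAbs
  nlinarith

theorem abs_smoothAbs_le {ε : ℝ} (hε : 0 < ε) (s : ℝ) : |smoothAbs ε s| ≤ |s| := by
  simpa [smoothAbs_zero hε] using abs_smoothAbs_sub_le ε s 0

theorem tendsto_smoothAbs (s : ℝ) : Tendsto (fun ε => smoothAbs ε s) (𝓝[>] 0) (𝓝 |s|) := by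
  have : Continuous fun ε : ℝ => smoothAbs ε s := by
    unfold smoothAbs
    fun_prop
  have h := this.tendsto 0
  simp only [smoothAbs, ne_eq, OfNat.ofNat_ne_zero, not_false_eq_true, zero_pow, add_zero, sub_zero,
    Real.sqrt_sq_eq_abs] at h
  exact h.mono_left nhdsWithin_le_nhds

theorem pderiv_smoothAbs_sq_le {ε : ℝ} (hε : 0 < ε) {a : Eucl n → ℝ} (ha : ContDiff ℝ 1 a)
    (i : Fin n) (x : Eucl n) : pderiv i (fun y => smoothAbs ε (a y)) x ^ 2 ≤ pderiv i a x ^ 2 := by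
  have hd : DifferentiableAt ℝ (smoothAbs ε) (a x) :=
    (contDiff_smoothAbs hε).differentiable one_ne_zero _
  have e : pderiv i (fun y => smoothAbs ε (a y)) x = deriv (smoothAbs ε) (a x) * pderiv i a x := by
    unfold pderiv
    have := fderiv_comp x hd (ha.differentiable one_ne_zero x)
    rw [Function.comp_def] at this
    rw [this]
    simp [mul_comm]
  have hle : |deriv (smoothAbs ε) (a x)| ≤ 1 := by
    have := norm_deriv_le_of_lip' (f := smoothAbs ε) (x₀ := a x) zero_le_one
      (Eventually.of_forall fun t => by simpa using abs_smoothAbs_sub_le ε t (a x))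
    simpa using this
  rw [e, mul_pow]
  exact mul_le_of_le_one_left (sq_nonneg _) ((sq_le_one_iff_abs_le_one _).2 hle)

theorem integrable_abs_pairDensity (hJ : IsTruncatedKernel J δ) {a : Eucl n → ℝ}
    (ha : ContDiff ℝ 1 a) (hcs : HasCompactSupport a) :
    Integrable (pairDensity J (fun x => |a x|) fun x => |a x|) := by
  have hac := ha.continuous
  refine (integrable_pairDensity hJ ha ha hcs).mono' ?_ (Eventually.of_forall fun p => ?_)
  · exact (Measurable.mul (by fun_prop) hJ.measurable_sub).aestronglyMeasurable
  · have hJz := hJ.nonneg (p.1 - p.2)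
    unfold pairDensity
    rw [Real.norm_of_nonneg (mul_nonneg (mul_self_nonneg _) hJz), ← sq, ← sq]
    gcongr ?_ * _
    exact sq_le_sq.2 (abs_abs_sub_abs_le_abs_sub _ _)

/-- Replacing `a` by `|a|` in a nonnegative second variation. -/
theorem integral_abs_sub_le_secondVariation (hJ : IsTruncatedKernel J δ)
    {w a : Eucl n → ℝ} (hw : Continuous w)
    (hpos : ∀ ζ : Eucl n → ℝ, ContDiff ℝ 1 ζ → HasCompactSupport ζ → 0 ≤ secondVariation J c w ζ)
    (ha : ContDiff ℝ 1 a) (hcs : HasCompactSupport a) :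
    Integrable (fun p : Eucl n × Eucl n => (|a p.1 * a p.2| - a p.1 * a p.2) * J (p.1 - p.2)) ∧
      c * ∫ p : Eucl n × Eucl n, (|a p.1 * a p.2| - a p.1 * a p.2) * J (p.1 - p.2) ≤
        secondVariation J c w a := by
  have hac := ha.continuous
  have i1 := integrable_pairDensity hJ ha ha hcs
  have i2 := integrable_abs_pairDensity hJ ha hcs
  have e : ∀ p : Eucl n × Eucl n, (|a p.1 * a p.2| - a p.1 * a p.2) * J (p.1 - p.2) =
      1 / 2 * (pairDensity J a a p - pairDensity J (fun x => |a x|) (fun x => |a x|) p) := by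
    intro p
    simp only [pairDensity, abs_mul]
    linear_combination (1 / 2 * J (p.1 - p.2)) * (sq_abs (a p.1) + sq_abs (a p.2))
  have hwi : Integrable fun x => w x * a x ^ 2 :=
    Continuous.integrable_of_hasCompactSupport (by fun_prop) hcs.fun_sq.mul_left
  -- As `|a|` need not be `C¹`, positivity is applied to `smoothAbs ε ∘ a`. The gradient term is
  -- only compared with that of `a`; the other two terms converge as `ε → 0`.
  have hlim : ∫ x, w x * a x ^ 2 ≤ (∑ i, ∫ x, pderiv i a x ^ 2) +
      c / 2 * ∫ p, pairDensity J (fun x => |a x|) (fun x => |a x|) p := by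
    have l1 : Tendsto (fun ε => ∫ x, w x * smoothAbs ε (a x) ^ 2) (𝓝[>] 0)
        (𝓝 (∫ x, w x * a x ^ 2)) := by
      refine tendsto_integral_filter_of_dominated_convergence (fun x => ‖w x * a x ^ 2‖) ?_ ?_
        hwi.norm (Eventually.of_forall fun x => ?_)
      · filter_upwards [self_mem_nhdsWithin] with ε hε
        have := (contDiff_smoothAbs hε).continuous
        exact Continuous.aestronglyMeasurable (by fun_prop)
      · filter_upwards [self_mem_nhdsWithin] with ε hε
        refine Eventually.of_forall fun x => ?_
        rw [norm_mul, norm_mul, norm_pow, norm_pow]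
        gcongr
        exact abs_smoothAbs_le hε _
      · simpa using ((tendsto_smoothAbs (a x)).pow 2).const_mul (w x)
    have l2 : Tendsto (fun ε => ∫ p, pairDensity J (fun x => smoothAbs ε (a x))
        (fun x => smoothAbs ε (a x)) p) (𝓝[>] 0)
        (𝓝 (∫ p, pairDensity J (fun x => |a x|) (fun x => |a x|) p)) := by
      refine tendsto_integral_filter_of_dominated_convergence (pairDensity J a a) ?_ ?_
        i1 (Eventually.of_forall fun p => ?_)
      · filter_upwards [self_mem_nhdsWithin] with ε hε
        have := (contDiff_smoothAbs hε).continuous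
        exact (Measurable.mul (by fun_prop) hJ.measurable_sub).aestronglyMeasurable
      · filter_upwards [self_mem_nhdsWithin] with ε hε
        refine Eventually.of_forall fun p => ?_
        have hJz := hJ.nonneg (p.1 - p.2)
        unfold pairDensity
        rw [Real.norm_of_nonneg (mul_nonneg (mul_self_nonneg _) hJz), ← sq, ← sq]
        gcongr ?_ * _
        exact sq_le_sq.2 (abs_smoothAbs_sub_le _ _ _)
      · have := (tendsto_smoothAbs (a p.1)).sub (tendsto_smoothAbs (a p.2))
        exact (this.mul this).mul_const _
    refine le_of_tendsto_of_tendsto l1 (tendsto_const_nhds.add (l2.const_mul _)) ?_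
    filter_upwards [self_mem_nhdsWithin] with ε hε
    have hs : ContDiff ℝ 1 fun x => smoothAbs ε (a x) := (contDiff_smoothAbs hε).comp ha
    have hsc : HasCompactSupport fun x => smoothAbs ε (a x) := hcs.comp_left (smoothAbs_zero hε)
    have h1 := hpos _ hs hsc
    have h2 : ∑ i, ∫ x, pderiv i (fun x => smoothAbs ε (a x)) x ^ 2 ≤
        ∑ i, ∫ x, pderiv i a x ^ 2 :=
      Finset.sum_le_sum fun i _ => integral_mono (integrable_pderiv_sq i hs hsc)
        (integrable_pderiv_sq i ha hcs) fun x => pderiv_smoothAbs_sq_le hε ha i x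
    unfold secondVariation energy at h1
    linarith
  simp only [e]
  refine ⟨(i1.sub i2).const_mul _, ?_⟩
  rw [integral_const_mul, integral_sub i1 i2]
  unfold secondVariation energy
  linarith

end stable

/-! ### Propagation of the sign -/

section sign

variable {n : ℕ} {J : Eucl n → ℝ} {δ c : ℝ}

/-- A solution of the linearized equation that is nonnegative near a point is nonnegative
within the range of the kernel. -/
theorem IsWeakSolution.nonneg_of_nonneg_near (hJ : IsTruncatedKernel J δ) (hc : 0 < c)
    {κ δ₁ : ℝ} (hκ : 0 < κ) (hlow : ∀ z, z ≠ 0 → ‖z‖ < δ₁ → κ ≤ J z)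
    {v w : Eucl n → ℝ} (h : IsWeakSolution J c v fun x => w x * v x) (hv : ContDiff ℝ 1 v)
    (hw : Continuous w)
    (hpos : ∀ ζ : Eucl n → ℝ, ContDiff ℝ 1 ζ → HasCompactSupport ζ → 0 ≤ secondVariation J c w ζ)
    {C R₀ : ℝ} (hC : ∀ R, R₀ ≤ R → ∫ x in Metric.closedBall 0 R, v x ^ 2 ≤ C * R ^ 2)
    {x₀ y₀ : Eucl n} {r : ℝ} (hr : 0 < r) (hx₀ : ∀ x ∈ Metric.ball x₀ r, 0 ≤ v x)
    (hxy : ‖x₀ - y₀‖ < δ₁) : 0 ≤ v y₀ := by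
  by_contra hneg
  push Not at hneg
  set m : ℝ := -v y₀ / 2 with hm
  have hm0 : 0 < m := by linarith
  obtain ⟨r₁, hr₁, hr₁'⟩ := Metric.eventually_nhds_iff.1
    ((hv.continuous.tendsto y₀).eventually_lt_const (by linarith : v y₀ < -m))
  -- On the `s`-balls, `v ≥ 0` around `x₀`, `v < -m` around `y₀`, and any two points, one in each
  -- ball, are less than `δ₁` apart.
  set s : ℝ := min (min r r₁) ((δ₁ - ‖x₀ - y₀‖) / 2) with hs
  have hs0 : 0 < s := lt_min (lt_min hr hr₁) (by linarith)
  have hsr : s ≤ r := (min_le_left _ _).trans (min_le_left _ _)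
  have hsr₁ : s ≤ r₁ := (min_le_left _ _).trans (min_le_right _ _)
  have hsδ : s ≤ (δ₁ - ‖x₀ - y₀‖) / 2 := min_le_right _ _
  let ψ : ContDiffBump x₀ := ⟨s / 2, s, by linarith, by linarith⟩
  have hψ : ContDiff ℝ 1 ψ := ψ.contDiff
  set S : ℝ := secondVariation J c w ψ with hS
  set A : Set (Eucl n × Eucl n) := Metric.ball x₀ (s / 2) ×ˢ Metric.ball y₀ s with hA
  set R : ℝ := ‖x₀‖ + ‖y₀‖ + s with hR
  have hR1 : ∀ x ∈ Metric.ball x₀ s, ‖x‖ ≤ R := fun x hx => by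
    have := norm_le_insert' x x₀
    rw [mem_ball_iff_norm] at hx
    linarith [norm_nonneg y₀]
  have hR2 : ∀ y ∈ Metric.ball y₀ s, ‖y‖ ≤ R := fun y hy => by
    have := norm_le_insert' y y₀
    rw [mem_ball_iff_norm] at hy
    linarith [norm_nonneg x₀]
  have hψ0 : ∀ x, R < ‖x‖ → ψ x = 0 := fun x hx => by
    refine ψ.zero_of_le_dist (not_lt.1 fun hlt => ?_)
    exact absurd (hR1 x hlt) (not_le.2 hx)
  have hAo : IsOpen A := Metric.isOpen_ball.prod Metric.isOpen_ball
  have hAfin : volume A ≠ ⊤ :=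
    (Metric.isBounded_ball.prod Metric.isBounded_ball).measure_lt_top.ne
  have hV : 0 < volume.real A := by
    refine ENNReal.toReal_pos ?_ hAfin
    rw [hA, Measure.volume_eq_prod, Measure.prod_prod]
    exact mul_ne_zero (Metric.measure_ball_pos _ _ (by linarith)).ne'
      (Metric.measure_ball_pos _ _ hs0).ne'
  set V : ℝ := volume.real A with hVdef
  -- On `A` the perturbed function is at least `t` at the first point and below `-m` at the second.
  -- The gain is therefore linear in `t`, against a quadratic cost.
  have key : ∀ t, 0 < t → ∀ ε, 0 < ε → c * (V * (2 * t * m * κ)) ≤ ε + t ^ 2 * S := by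
    intro t ht ε hε
    obtain ⟨η, hη, hηc, hη1, hηε⟩ := exists_cutoff_weightedEnergy_le hJ hc.le hv hC (R + δ) hε
    have ha : ContDiff ℝ 1 fun x => v x * η x + t * ψ x :=
      (hv.mul hη).add (contDiff_const.mul hψ)
    have hac : HasCompactSupport fun x => v x * η x + t * ψ x :=
      HasCompactSupport.add hηc.mul_left ψ.hasCompactSupport.mul_left
    obtain ⟨hI, hle⟩ := integral_abs_sub_le_secondVariation hJ hw hpos ha hac
    rw [h.secondVariation_mul_add hJ hw hv hη hηc hψ ψ.hasCompactSupport hη1 hψ0 t] at hle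
    have hlower : V * (2 * t * m * κ) ≤ ∫ p : Eucl n × Eucl n,
        (|(v p.1 * η p.1 + t * ψ p.1) * (v p.2 * η p.2 + t * ψ p.2)| -
          (v p.1 * η p.1 + t * ψ p.1) * (v p.2 * η p.2 + t * ψ p.2)) * J (p.1 - p.2) := by
      have : V * (2 * t * m * κ) = ∫ p, A.indicator (fun _ => 2 * t * m * κ) p := by
        rw [integral_indicator_const _ hAo.measurableSet, smul_eq_mul]
      rw [this]
      refine integral_mono ((integrable_indicator_iff hAo.measurableSet).2
        (integrableOn_const hAfin)) hI fun p => ?_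
      by_cases hp : p ∈ A
      · rw [indicator_of_mem hp]
        have hp1 : p.1 ∈ Metric.ball x₀ (s / 2) := hp.1
        have hp2 : p.2 ∈ Metric.ball y₀ s := hp.2
        have hp1' : p.1 ∈ Metric.ball x₀ s := Metric.ball_subset_ball (by linarith) hp1
        have hδ := hJ.pos
        have hv1 : 0 ≤ v p.1 := hx₀ _ (Metric.ball_subset_ball hsr hp1')
        have hv2 : v p.2 < -m := hr₁' (lt_of_lt_of_le hp2 hsr₁)
        have hψ1 : ψ p.1 = 1 := ψ.one_of_mem_closedBall (Metric.ball_subset_closedBall hp1)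
        -- The support of `ψ` lies where `v ≥ 0`, so it cannot contain a point with `v < -m`.
        have hψ2 : ψ p.2 = 0 := by
          refine ψ.zero_of_le_dist (not_lt.1 fun hlt => ?_)
          have := hx₀ _ (Metric.ball_subset_ball hsr hlt)
          linarith
        have hne : p.1 - p.2 ≠ 0 := by
          intro h0
          rw [sub_eq_zero.1 h0] at hv1
          linarith
        have hnorm : ‖p.1 - p.2‖ < δ₁ := by
          have e : p.1 - p.2 = (p.1 - x₀) + (x₀ - y₀) + (y₀ - p.2) := by abel
          rw [mem_ball_iff_norm] at hp1' hp2
          rw [norm_sub_rev] at hp2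
          have := norm_add₃_le (a := p.1 - x₀) (b := x₀ - y₀) (c := y₀ - p.2)
          rw [← e] at this
          linarith
        have hJκ := hlow _ hne hnorm
        rw [hη1 p.1 (by linarith [hR1 _ hp1']), hη1 p.2 (by linarith [hR2 _ hp2]), hψ1, hψ2]
        simp only [mul_one, mul_zero, add_zero]
        have hprod : (v p.1 + t) * v p.2 ≤ -(t * m) := by nlinarith
        have habs : 2 * t * m ≤ |(v p.1 + t) * v p.2| - (v p.1 + t) * v p.2 := by
          have := neg_le_abs ((v p.1 + t) * v p.2)
          linarith
        have htm : 0 ≤ 2 * t * m := by positivity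
        exact mul_le_mul habs hJκ hκ.le (htm.trans habs)
      · rw [indicator_of_notMem hp]
        exact mul_nonneg (sub_nonneg.2 (le_abs_self _)) (hJ.nonneg _)
    calc _ ≤ _ := mul_le_mul_of_nonneg_left hlower hc.le
      _ ≤ _ := hle
      _ ≤ _ := by gcongr
  have key' : ∀ t, 0 < t → c * (V * (2 * t * m * κ)) ≤ t ^ 2 * S := fun t ht =>
    le_of_forall_pos_le_add fun ε hε => by linarith [key t ht ε hε]
  set q : ℝ := c * V * m * κ with hq
  have hq0 : 0 < q := by positivity
  have hS1 : 0 < |S| + 1 := by positivity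
  -- With this `t` one has `t S ≤ q`, contradicting `2 q ≤ t S`.
  have hk := key' (q / (|S| + 1)) (by positivity)
  have h1 : 2 * q ≤ q / (|S| + 1) * S := by
    have ht : 0 < q / (|S| + 1) := by positivity
    refine le_of_mul_le_mul_left ?_ ht
    calc _ = c * (V * (2 * (q / (|S| + 1)) * m * κ)) := by
          rw [hq]
          ring
      _ ≤ _ := hk
      _ = _ := by ring
  have h2 : q / (|S| + 1) * S ≤ q := by
    rw [div_mul_eq_mul_div, div_le_iff₀ hS1]
    exact mul_le_mul_of_nonneg_left (by linarith [le_abs_self S]) hq0.le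
  linarith

/-- A solution of the linearized equation that is positive somewhere is nonnegative. -/
theorem IsWeakSolution.nonneg_of_pos (hJ : IsTruncatedKernel J δ) (hc : 0 < c)
    {κ δ₁ : ℝ} (hκ : 0 < κ) (hδ₁ : 0 < δ₁) (hlow : ∀ z, z ≠ 0 → ‖z‖ < δ₁ → κ ≤ J z)
    {v w : Eucl n → ℝ} (h : IsWeakSolution J c v fun x => w x * v x) (hv : ContDiff ℝ 1 v)
    (hw : Continuous w)
    (hpos : ∀ ζ : Eucl n → ℝ, ContDiff ℝ 1 ζ → HasCompactSupport ζ → 0 ≤ secondVariation J c w ζ)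
    {C R₀ : ℝ} (hC : ∀ R, R₀ ≤ R → ∫ x in Metric.closedBall 0 R, v x ^ 2 ≤ C * R ^ 2)
    {x₀ : Eucl n} (hx₀ : 0 < v x₀) (y : Eucl n) : 0 ≤ v y := by
  -- Propagation starts from a neighbourhood, hence the interior of `P`. Each of its points brings a
  -- ball of the fixed radius `δ₁` into `P`, so the interior is closed, and connectedness concludes.
  set P : Set (Eucl n) := {x | 0 ≤ v x} with hP
  have hsub : ∀ x ∈ interior P, 0 ≤ v x := fun x hx => by simpa [hP] using interior_subset hx
  have hstep : ∀ x ∈ interior P, Metric.ball x δ₁ ⊆ P := by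
    intro x hx z hz
    obtain ⟨r, hr, hr'⟩ := Metric.isOpen_iff.1 isOpen_interior x hx
    change 0 ≤ v z
    refine h.nonneg_of_nonneg_near hJ hc hκ hlow hv hw hpos hC hr
      (fun x' hx' => hsub x' (hr' hx')) ?_
    rw [norm_sub_rev]
    exact mem_ball_iff_norm.1 hz
  have hclosed : IsClosed (interior P) := by
    refine isClosed_of_closure_subset fun x hx => ?_
    obtain ⟨z, hz, hxz⟩ := Metric.mem_closure_iff.1 hx δ₁ hδ₁
    exact interior_maximal (hstep z hz) Metric.isOpen_ball hxz
  have huniv := IsClopen.eq_univ ⟨hclosed, isOpen_interior⟩ ⟨x₀, ?_⟩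
  · exact hsub y (huniv ▸ mem_univ y)
  · refine mem_interior.2 ⟨{x | 0 < v x}, fun x hx => le_of_lt (by simpa using hx),
      isOpen_lt continuous_const hv.continuous, hx₀⟩

end sign

/-! ### One-dimensionality and conclusion -/

/-- A function all of whose directional derivatives have a sign is one-dimensional. -/
theorem isOneDimensional_of_fderiv_sign {n : ℕ} [NeZero n] {u : Eucl n → ℝ} (hu : ContDiff ℝ 2 u)
    (hsgn : ∀ e x y, 0 < fderiv ℝ u x e → 0 ≤ fderiv ℝ u y e) : IsOneDimensional u := by
  have hd : Differentiable ℝ u := hu.differentiable two_ne_zero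
  by_cases h0 : ∀ x, fderiv ℝ u x = 0
  · refine ⟨EuclideanSpace.single 0 1, by simp, fun _ => u 0, contDiff_const, fun x => ?_⟩
    exact is_const_of_fderiv_eq_zero hd h0 x 0
  push Not at h0
  obtain ⟨x₀, hx₀⟩ := h0
  set a : Eucl n := gradient u x₀ with ha
  have hDa : ∀ e, fderiv ℝ u x₀ e = inner ℝ a e := fun e => by
    rw [ha, gradient, InnerProductSpace.toDual_symm_apply]
  have ha0 : a ≠ 0 := by
    intro h
    refine hx₀ (ContinuousLinearMap.ext fun e => ?_)
    rw [hDa, h, inner_zero_left]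
    rfl
  -- The tilted direction `e + s a` has derivative `s |a|² > 0` at `x₀`, so the sign hypothesis
  -- applies; then `s → 0`.
  have hnn : ∀ e, inner ℝ a e = 0 → ∀ y, 0 ≤ fderiv ℝ u y e := by
    intro e he y
    have hs : ∀ s : ℝ, 0 < s → 0 ≤ fderiv ℝ u y e + s * fderiv ℝ u y a := by
      intro s hs
      have := hsgn (e + s • a) x₀ y (by
        rw [hDa, inner_add_right, he, inner_smul_right, zero_add, real_inner_self_eq_norm_sq]
        have := norm_pos_iff.2 ha0
        positivity)
      simpa using this
    have hlim : Tendsto (fun s : ℝ => fderiv ℝ u y e + s * fderiv ℝ u y a) (𝓝[>] 0)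
        (𝓝 (fderiv ℝ u y e + 0 * fderiv ℝ u y a)) :=
      ((continuous_const.add (continuous_id.mul continuous_const)).tendsto 0).mono_left
        nhdsWithin_le_nhds
    rw [zero_mul, add_zero] at hlim
    exact ge_of_tendsto hlim (by filter_upwards [self_mem_nhdsWithin] with s using hs s)
  have hzero : ∀ e, inner ℝ a e = 0 → ∀ y, fderiv ℝ u y e = 0 := by
    intro e he y
    refine le_antisymm ?_ (hnn e he y)
    have := hnn (-e) (by rw [inner_neg_right, he, neg_zero]) y
    rw [map_neg] at this
    linarith
  have hna : ‖a‖ ≠ 0 := norm_ne_zero_iff.2 ha0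
  refine ⟨‖a‖⁻¹ • a, by rw [norm_smul, norm_inv, norm_norm, inv_mul_cancel₀ hna],
    fun t => u (t • ‖a‖⁻¹ • a), hu.comp (contDiff_id.smul contDiff_const), fun x => ?_⟩
  set p : Eucl n := inner ℝ (‖a‖⁻¹ • a) x • ‖a‖⁻¹ • a with hp
  have hperp : inner ℝ a (x - p) = 0 := by
    rw [hp, inner_sub_right, inner_smul_right, inner_smul_right, real_inner_smul_left,
      real_inner_self_eq_norm_sq]
    field_simp
    ring
  have hconst := is_const_of_deriv_eq_zero (f := fun t : ℝ => u (p + t • (x - p)))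
    (fun t => (hasDerivAt_translate hd p (x - p) t).differentiableAt)
    (fun t => by rw [(hasDerivAt_translate hd p (x - p) t).deriv, hzero _ hperp]) 1 0
  simpa using hconst

/-- All that the sign argument needs from the lower bound: its smallest value on the punctured ball,
attained at radius `δ₁`. -/
theorem TruncatedBounds.exists_pos_le {n : ℕ} {J : Eucl n → ℝ} {α β lam Lam δ₀ δ₁ : ℝ}
    (hβ : 0 < β) (hlam : 0 < lam) (hδ₁ : 0 < δ₁) (h : TruncatedBounds J α β lam Lam δ₀ δ₁) :
    ∃ κ : ℝ, 0 < κ ∧ ∀ z, z ≠ 0 → ‖z‖ < δ₁ → κ ≤ J z := by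
  refine ⟨lam / δ₁ ^ ((n : ℝ) + β), div_pos hlam (Real.rpow_pos_of_pos hδ₁ _), fun z hz hzδ => ?_⟩
  have h1 := (h z hz).1
  rw [indicator_of_mem (by simpa using hzδ.le)] at h1
  refine le_trans ?_ h1
  have := Real.rpow_pos_of_pos (norm_pos_iff.2 hz) ((n : ℝ) + β)
  gcongr

theorem theorem2p3 (J : Eucl 2 → ℝ) (hJ : IsJumpKernel J)
    (α β lam Lam δ₀ δ₁ : ℝ) (hα : 0 < α) (hα2 : α < 2) (hβ : 0 < β) (hβ2 : β < 2)
    (hlam : 0 < lam) (hLam : lam ≤ Lam) (hδ₁ : 0 < δ₁) (hδ₀ : δ₁ ≤ δ₀)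
    (hJb : TruncatedBounds J α β lam Lam δ₀ δ₁)
    (c : ℝ) (hc : 0 < c) (f : ℝ → ℝ) (hf : ContDiff ℝ 1 f)
    (u : Eucl 2 → ℝ) (hbdd : ∃ M : ℝ, ∀ x, |u x| ≤ M)
    (hsol : IsSolution J c f u) (hstable : IsStable J c f u) :
    IsOneDimensional u := by
  obtain ⟨M, hM⟩ := hbdd
  have hK : IsTruncatedKernel J δ₀ := hJb.isTruncatedKernel hJ hα2 (hδ₁.trans_le hδ₀)
  obtain ⟨κ, hκ, hlow⟩ := hJb.exists_pos_le hβ hlam hδ₁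
  have hu := hsol.contDiff
  have hu1 : ContDiff ℝ 1 u := hu.of_le (by norm_num)
  have hweak := hsol.isWeakSolution hK hc.ne' hf.continuous hM
  obtain ⟨G, hG⟩ := (isCompact_Icc (a := -M) (b := M)).exists_bound_of_continuousOn
    hf.continuous.continuousOn
  obtain ⟨C, R₀, hC⟩ := hweak.exists_setIntegral_pderiv_sq_le hK hc.le hu1
    (hf.continuous.comp hu.continuous) hM fun x => hG _ (abs_le.1 (hM x))
  refine isOneDimensional_of_fderiv_sign hu fun e x y hx => ?_
  have hv : ContDiff ℝ 1 fun x => fderiv ℝ u x e :=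
    (hu.fderiv_right (m := 1) (by norm_num)).clm_apply contDiff_const
  refine (hweak.fderiv_apply hK hf hu e).nonneg_of_pos (w := fun x => deriv f (u x)) hK hc hκ hδ₁
    hlow hv ((hf.continuous_deriv le_rfl).comp hu.continuous)
    (fun ζ hζ hζc => hstable.secondVariation_nonneg hζ hζc) (C := ‖e‖ ^ 2 * C) (R₀ := R₀)
    (fun R hR => ?_) hx y
  have hcont : Continuous fun x => ∑ i, pderiv i u x ^ 2 :=
    continuous_finsetSum _ fun i _ => (continuous_pderiv hu1).pow 2
  -- The growth of `∫ |∇u|²` passes to the directional derivative through `|∂ₑu| ≤ |e| |∇u|`.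
  calc ∫ x in Metric.closedBall 0 R, fderiv ℝ u x e ^ 2
      ≤ ∫ x in Metric.closedBall 0 R, ‖e‖ ^ 2 * ∑ i, pderiv i u x ^ 2 := by
        refine setIntegral_mono
          ((hv.continuous.pow 2).continuousOn.integrableOn_compact (isCompact_closedBall _ _))
          ((continuous_const.mul hcont).continuousOn.integrableOn_compact (isCompact_closedBall _ _))
          fun x => ?_
        simp only
        rw [← norm_fderiv_sq, ← mul_pow, mul_comm, ← sq_abs]
        gcongr
        exact (fderiv ℝ u x).le_opNorm e
    _ = ‖e‖ ^ 2 * ∫ x in Metric.closedBall 0 R, ∑ i, pderiv i u x ^ 2 := integral_const_mul _ _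
    _ ≤ ‖e‖ ^ 2 * (C * R ^ 2) := by
        gcongr
        exact hC R hR
    _ = _ := by ring
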